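/- Let $p$ be an odd prime, let $\zeta_2$ be a primitive $p^2$-th root of unity, $\zeta_1=\zeta_2^p$, $\mathbb K=\mathbb Q(\zeta_1)$, and let $C$ be a cyclic group of order $p^2$. Let $F=\mathbb Z[\zeta_1]/(p)$, let $j_1:\mathbb Z[\zeta_1]\to F$ be the quotient map, let $j_2:\mathbb Z[\zeta_2]\to F$ be the ring homomorphism with $j_2(\zeta_2)=j_1(\zeta_1)$, and let $A=\{(a_1,a_2)\in\mathbb Z[\zeta_1]\times\mathbb Z[\zeta_2] : j_1(a_1)=j_2(a_2)\}$. An ideal $\alpha$ is called prime to $p$ if $\alpha+(p)=(1)$. For ideals $\alpha_k\subseteq\mathbb Z[\zeta_k]$ prime to $p$ ($k=1,2$) and a unit $h\in F^\times$ let $$M(\alpha_1,\alpha_2,h)=\{(a_1,a_2)\in\alpha_1\times\alpha_2 : j_1(a_1)=h\,j_2(a_2)\},$$ which is an invertible $A$-module. The ring homomorphism $\mathbb ZC\to A$ sending a generator of $C$ to $(\zeta_1,\zeta_2)$ induces an isomorphism $\mathrm{Pic}(\mathbb ZC)\cong\mathrm{Pic}(A)$. There is a homomorphism $\psi:Cl(\mathbb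 Z[\zeta_2])\to\mathrm{Pic}(A)$ with $\psi([\alpha])=[M(N\alpha,\alpha,1)]$ for all ideals $\alpha$ prime to $p$, where $N$ is the ideal norm from $\mathbb Z[\zeta_2]$ to $\mathbb Z[\zeta_1]$. It splits the canonical projection $\mathrm{Pic}(A)\to \mathrm{Pic}(\mathbb Z[\zeta_2])=Cl(\mathbb Z[\zeta_2])$. Let $B$ be the kernel of this projection, so that $\mathrm{Pic}(A)=\psi(Cl(\mathbb Z[\zeta_2]))\oplus B$; it consists of the classes of the modules $M(\alpha,\mathbb Z[\zeta_2],h)$ with $\alpha$ an ideal of $\mathbb Z[\zeta_1]$ prime to $p$ and $h\in F^\times$. Let $I_0(\mathbb K)$ be the group of fractional ideals of $\mathbb K$ prime to $p$, and let $H\subseteq I_0(\mathbb K)$ be the subgroup of the principal fractional ideals that have a generator $g\equiv 1 \bmod p$, that is, $g=x/y$ with $x,y\in\mathbb Z[\zeta_1]$, $y$ prime to $p$ and $x\equiv y\bmod p$. **Theorem 2.1.** The map sending the class of $M(\alpha,\mathbb Z[\zeta_2],h)$ to the class of $h^{-1}\alpha$, that is, of $(x)^{-1}\alpha$ for any $x\in\mathbb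 Z[\zeta_1]$ with $j_1(x)=h$, is a well-defined group isomorphism $B\cong I_0(\mathbb K)/H$, and it restricts to an isomorphism $B_p\cong (I_0(\mathbb K)/H)_p$ of the Sylow $p$-subgroups. -/

import Mathlib

open NumberField CommRing
open scoped nonZeroDivisors

noncomputable section

namespace CyclicPic

/-! ### The rings -/

section Rings

variable (p : ℕ) [Fact p.Prime]

/-- The ideal `(p)` of a commutative ring `R`. -/
abbrev pIdeal (R : Type*) [CommRing R] : Ideal R := Ideal.span {(p : R)}

/-- The local ring `F = ℤ[ζ₁]/(p)`, where `ℤ[ζ₁] = 𝓞 K`. -/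
abbrev F (K : Type*) [Field K] [NumberField K] : Type _ := 𝓞 K ⧸ pIdeal p (𝓞 K)

/-- The canonical map `j₁ : ℤ[ζ₁] → F`. -/
abbrev j₁ (K : Type*) [Field K] [NumberField K] : 𝓞 K →+* F p K :=
  Ideal.Quotient.mk (pIdeal p (𝓞 K))

variable {p}
variable {K : Type*} [Field K] [NumberField K]
variable {L : Type*} [Field L] [NumberField L] [IsCyclotomicExtension {p ^ 2} ℚ L]
variable {ζ₁ : K} (h₁ : IsPrimitiveRoot ζ₁ p) {ζ₂ : L} (h₂ : IsPrimitiveRoot ζ₂ (p ^ 2))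

theorem aeval_minpoly_eq_zero :
    Polynomial.aeval (j₁ p K h₁.toInteger)
      (minpoly ℤ h₂.integralPowerBasisOfPrimePow.gen) = 0 := by
  have hgen : minpoly ℤ h₂.integralPowerBasisOfPrimePow.gen =
      Polynomial.cyclotomic (p ^ 2) ℤ := by
    rw [Polynomial.cyclotomic_eq_minpoly h₂ (NeZero.pos _), h₂.integralPowerBasisOfPrimePow_gen]
    exact (minpoly.algebraMap_eq (B' := L) RingOfIntegers.coe_injective h₂.toInteger).symm
  have hone : h₁.toInteger ^ p = 1 := h₁.toInteger_isPrimitiveRoot.pow_eq_one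
  rw [hgen, Polynomial.cyclotomic_prime_pow_eq_geom_sum (Fact.out : p.Prime)]
  simp only [pow_one, map_sum, map_pow, Polynomial.aeval_X]
  simp only [← map_pow, hone, map_one, one_pow, Finset.sum_const, Finset.card_range, nsmul_eq_mul,
    mul_one]
  rw [← map_natCast (Ideal.Quotient.mk (pIdeal p (𝓞 K))), Ideal.Quotient.eq_zero_iff_mem]
  exact Ideal.mem_span_singleton_self _

/-- The canonical map `j₂ : ℤ[ζ₂] → F`, the ring homomorphism that sends `ζ₂` to the class
of `ζ₁`. -/
def j₂ : 𝓞 L →+* F p K :=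
  (h₂.integralPowerBasisOfPrimePow.lift (j₁ p K h₁.toInteger)
    (aeval_minpoly_eq_zero h₁ h₂)).toRingHom

theorem j₂_toInteger : j₂ h₁ h₂ h₂.toInteger = j₁ p K h₁.toInteger := by
  have := h₂.integralPowerBasisOfPrimePow.lift_gen (j₁ p K h₁.toInteger)
    (aeval_minpoly_eq_zero h₁ h₂)
  rwa [h₂.integralPowerBasisOfPrimePow_gen] at this

/-- The ring `A`, the Cartesian (fibre) product of `ℤ[ζ₁]` and `ℤ[ζ₂]` over `F`. -/
def A : Subring (𝓞 K × 𝓞 L) :=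
  RingHom.eqLocus ((j₁ p K).comp (RingHom.fst (𝓞 K) (𝓞 L)))
    ((j₂ h₁ h₂).comp (RingHom.snd (𝓞 K) (𝓞 L)))

theorem mem_A {x : 𝓞 K × 𝓞 L} : x ∈ A h₁ h₂ ↔ j₁ p K x.1 = j₂ h₁ h₂ x.2 := Iff.rfl

/-- The projection `A → ℤ[ζ₂]`. -/
def projTwo : A h₁ h₂ →+* 𝓞 L := (RingHom.snd (𝓞 K) (𝓞 L)).comp (A h₁ h₂).subtype

/-- The element `(ζ₁, ζ₂)` of `A`. -/
def zetaPair : A h₁ h₂ := ⟨(h₁.toInteger, h₂.toInteger), (j₂_toInteger h₁ h₂).symm⟩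

theorem zetaPair_pow : zetaPair h₁ h₂ ^ (p ^ 2) = 1 := by
  apply Subtype.ext
  refine Prod.ext ?_ ?_
  · change h₁.toInteger ^ (p ^ 2) = 1
    rw [pow_two, pow_mul, h₁.toInteger_isPrimitiveRoot.pow_eq_one, one_pow]
  · change h₂.toInteger ^ (p ^ 2) = 1
    exact h₂.toInteger_isPrimitiveRoot.pow_eq_one

/-- The homomorphism from the cyclic group of order `n` that sends the generator to `a`,
where `a ^ n = 1`. -/
def cyclicHom {G : Type*} [Monoid G] (n : ℕ) [NeZero n] (a : G) (ha : a ^ n = 1) :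
    Multiplicative (ZMod n) →* G where
  toFun k := a ^ (Multiplicative.toAdd k).val
  map_one' := by simp
  map_mul' x y := by
    rw [toAdd_mul, ZMod.val_add, ← pow_add, ← pow_mod_orderOf,
      Nat.mod_mod_of_dvd _ (orderOf_dvd_of_pow_eq_one ha), pow_mod_orderOf]

/-- The integral group ring `ℤ C` of the cyclic group `C` of order `p ^ 2`. -/
abbrev GroupRing (p : ℕ) : Type := MonoidAlgebra ℤ (Multiplicative (ZMod (p ^ 2)))

/-- The canonical ring homomorphism `ℤ C → A` that sends the generator of `C` to `(ζ₁, ζ₂)`. -/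
def groupRingToA : GroupRing p →+* A h₁ h₂ :=
  (MonoidAlgebra.lift ℤ (A h₁ h₂) (Multiplicative (ZMod (p ^ 2)))
    (cyclicHom (p ^ 2) (zetaPair h₁ h₂) (zetaPair_pow h₁ h₂))).toRingHom

/-! ### Invertible modules over `A` -/

/-- The module `M(α₁, α₂, h)` for ideals `α₁`, `α₂` of `ℤ[ζ₁]`, `ℤ[ζ₂]` and a unit `h` of `F`:
the `A`-module of all `(a₁, a₂) ∈ α₁ × α₂` with `j₁ a₁ = h * j₂ a₂`.
If `α₁`, `α₂` are prime to `p`, then `j₁`, `j₂` identify `F ⊗ α₁`, `F ⊗ α₂` with `F`, and this is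
the module obtained by gluing `α₁` and `α₂` along multiplication by `h` on `F`. -/
def M (α₁ : Ideal (𝓞 K)) (α₂ : Ideal (𝓞 L)) (h : (F p K)ˣ) :
    Submodule (A h₁ h₂) (𝓞 K × 𝓞 L) where
  carrier := {x | x.1 ∈ α₁ ∧ x.2 ∈ α₂ ∧ j₁ p K x.1 = h * j₂ h₁ h₂ x.2}
  zero_mem' := by simp
  add_mem' := by
    rintro x y ⟨hx₁, hx₂, hx⟩ ⟨hy₁, hy₂, hy⟩
    refine ⟨add_mem hx₁ hy₁, add_mem hx₂ hy₂, ?_⟩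
    rw [Prod.fst_add, Prod.snd_add, map_add, map_add, hx, hy, mul_add]
  smul_mem' := by
    rintro c x ⟨hx₁, hx₂, hx⟩
    refine ⟨α₁.mul_mem_left c.1.1 hx₁, α₂.mul_mem_left c.1.2 hx₂, ?_⟩
    change j₁ p K (c.1.1 * x.1) = h * j₂ h₁ h₂ (c.1.2 * x.2)
    rw [map_mul, map_mul, hx, (mem_A h₁ h₂).1 c.2]
    ring

/-- `X` is the class of the `A`-module `P` in the Picard group of `A`. -/
def IsClassOf (X : Pic (A h₁ h₂)) (P : Submodule (A h₁ h₂) (𝓞 K × 𝓞 L)) : Prop :=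
  Nonempty (X ≃ₗ[A h₁ h₂] P)

/-- The subgroup `B` of `Pic A`, the kernel of the canonical projection `Pic A → Pic ℤ[ζ₂]`. -/
def B : Subgroup (Pic (A h₁ h₂)) := (Pic.mapRingHom (projTwo h₁ h₂)).ker

end Rings

/-! ### The ray class group -/

section Ray

/-- An integral ideal is prime to `p`. -/
def PrimeTo (p : ℕ) {R : Type*} [CommRing R] (I : Ideal R) : Prop := IsCoprime I (pIdeal p R)

theorem primeTo_top (p : ℕ) {R : Type*} [CommRing R] : PrimeTo p (1 : Ideal R) :=
  isCoprime_one_left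

theorem primeTo_span {p : ℕ} {K : Type*} [Field K] [NumberField K] {x : 𝓞 K} {h : (F p K)ˣ}
    (hx : j₁ p K x = h) :
    PrimeTo p (Ideal.span {x}) := by
  have hu : IsUnit (j₁ p K x) := hx ▸ h.isUnit
  obtain ⟨c, hc⟩ := hu.exists_left_inv
  obtain ⟨y, rfl⟩ := Ideal.Quotient.mk_surjective c
  rw [← map_mul, ← map_one (j₁ p K), Ideal.Quotient.eq, Ideal.mem_span_singleton'] at hc
  obtain ⟨a, ha⟩ := hc
  rw [PrimeTo, pIdeal, Ideal.isCoprime_span_singleton_iff]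
  exact ⟨y, -a, by linear_combination -ha⟩

variable (p : ℕ) [Fact p.Prime] (K : Type*) [Field K] [NumberField K]

variable {p K} in
theorem PrimeTo.ne_zero {I : Ideal (𝓞 K)} (hI : PrimeTo p I) :
    (I : FractionalIdeal (𝓞 K)⁰ K) ≠ 0 := by
  rintro h
  rw [FractionalIdeal.coeIdeal_eq_zero] at h
  subst h
  have hu : IsUnit ((p : ℤ) : ℤ) := by
    have h1 : IsUnit (pIdeal p (𝓞 K)) := isCoprime_zero_left.1 hI
    rw [Ideal.isUnit_iff, Ideal.span_singleton_eq_top] at h1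
    have h2 : IsUnit (algebraMap ℤ (𝓞 K) (p : ℤ)) := by simpa using h1
    exact isUnit_of_map_unit _ _ h2
  exact (Nat.prime_iff_prime_int.1 (Fact.out : p.Prime)).not_isUnit hu

variable {p K} in
/-- An integral ideal prime to `p`, as an invertible fractional ideal. -/
def PrimeTo.unit {I : Ideal (𝓞 K)} (hI : PrimeTo p I) : (FractionalIdeal (𝓞 K)⁰ K)ˣ :=
  Units.mk0 (I : FractionalIdeal (𝓞 K)⁰ K) hI.ne_zero

/-- The group `I₀(K)` of fractional ideals of `K` prime to `p`, that is, of all quotients of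
integral ideals prime to `p`. -/
def I₀ : Subgroup (FractionalIdeal (𝓞 K)⁰ K)ˣ where
  carrier := {J | ∃ (a b : Ideal (𝓞 K)) (ha : PrimeTo p a) (hb : PrimeTo p b),
    J = ha.unit / hb.unit}
  one_mem' := ⟨1, 1, primeTo_top p, primeTo_top p, by simp⟩
  mul_mem' := by
    rintro _ _ ⟨a, b, ha, hb, rfl⟩ ⟨c, d, hc, hd, rfl⟩
    have hac : PrimeTo p (a * c) := IsCoprime.mul_left ha hc
    have hbd : PrimeTo p (b * d) := IsCoprime.mul_left hb hd
    refine ⟨a * c, b * d, hac, hbd, ?_⟩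
    have h1 : hac.unit = ha.unit * hc.unit := Units.ext (by simp [PrimeTo.unit])
    have h2 : hbd.unit = hb.unit * hd.unit := Units.ext (by simp [PrimeTo.unit])
    rw [h1, h2, div_mul_div_comm]
  inv_mem' := by
    rintro _ ⟨a, b, ha, hb, rfl⟩
    exact ⟨b, a, hb, ha, by rw [inv_div]⟩

/-- The group of all `g ∈ Kˣ` with `g ≡ 1 mod p`: those of the form `g = x / y` with
`x, y ∈ 𝓞 K`, `y` prime to `p` and `x ≡ y mod p`. -/
def congrOne : Subgroup Kˣ where
  carrier := {g | ∃ x y : 𝓞 K, IsUnit (j₁ p K y) ∧ j₁ p K x = j₁ p K y ∧ (g : K) * algebraMap (𝓞 K) K y = algebraMap (𝓞 K) K x}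
  one_mem' := ⟨1, 1, by simp, rfl, by simp⟩
  mul_mem' := by
    rintro g g' ⟨x, y, hy, hxy, h⟩ ⟨x', y', hy', hxy', h'⟩
    refine ⟨x * x', y * y', by rw [map_mul]; exact hy.mul hy', by simp only [map_mul, hxy, hxy'],
      ?_⟩
    rw [Units.val_mul, map_mul, map_mul, ← h, ← h']
    ring
  inv_mem' := by
    rintro g ⟨x, y, hy, hxy, h⟩
    exact ⟨y, x, hxy ▸ hy, hxy.symm, by rw [← h, Units.val_inv_eq_inv_val,
      inv_mul_cancel_left₀ g.ne_zero]⟩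

/-- The ray ideal group `H`: the principal fractional ideals of `K` that possess a generator
`g ≡ 1 mod p`. -/
def H : Subgroup (FractionalIdeal (𝓞 K)⁰ K)ˣ := (congrOne p K).map (toPrincipalIdeal (𝓞 K) K)

/-- The quotient group `I₀(K) / H`. -/
abbrev RayClassGroup : Type _ := I₀ p K ⧸ (H p K).subgroupOf (I₀ p K)

variable {p K}

/-- The class in `I₀(K) / H` of an integral ideal prime to `p`. -/
def PrimeTo.rayClass {I : Ideal (𝓞 K)} (hI : PrimeTo p I) : RayClassGroup p K :=
  QuotientGroup.mk ⟨hI.unit, I, 1, hI, primeTo_top p, by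
    rw [eq_div_iff_mul_eq']; exact Units.ext (by simp [PrimeTo.unit])⟩

end Ray

end CyclicPic

end

/-! The group `Pic A` is computed from its fibre square. If a ring is the fibre product of two rings
over a local ring `F`, then every invertible module is obtained by gluing an ideal of each factor
along a unit `h` of `F`. Indeed, an identity `∑ fᵢ(xᵢ) = 1` between functionals and elements has a
summand that is a unit in `F`, and the functional in that summand embeds the module as an ideal
(`exists_picGlue_eq`). Glued modules multiply componentwise (`picGlue_mul`), and such a module is
trivial exactly when the ideals have generators `x`, `y` with `j₁ x = h * j₂ y`
(`picGlue_eq_one_iff`).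

For `M(α, ℤ[ζ₂], h)` the generator `y` is a unit of `ℤ[ζ₂]`. The arithmetic input is the congruence
`j₁ (N y) = j₂ y` (`j₁_intNorm`): dividing `x` by the unit `N y` removes `y`, so the class is
trivial if and only if `α` has a generator reducing to `h`. This is the condition for `h⁻¹α` to lie
in `H`, which gives the isomorphism. The same congruence makes `M(Nβ, β, 1)` free for principal `β`
and so yields the splitting.

The congruence holds because the norm of `P(ζ₂)` is `det P(S)`, where `S` is the companion matrix of
`X ^ p - ζ₁`, and in characteristic `p` this determinant is `P(ζ₁)`.

The comparison with `ℤ C` uses a second fibre square, of `ℤ` and `A` over `ℤ/p²`: `Pic ℤ` is trivial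
and cyclotomic units of `A` lift all units of `ℤ/p²`. -/

noncomputable section

/-! ### Elements and functionals of invertible modules -/

namespace Module.Invertible

variable {R X : Type*} [CommRing R] [AddCommGroup X] [Module R X] [Module.Invertible R X]

/-- In an invertible module `x ⊗ y = y ⊗ x`; apply `f ⊗ id`. This identity plays the role of rank
one in all that follows. -/
theorem dual_apply_smul_comm (f : Module.Dual R X) (x y : X) : f x • y = f y • x := by
  simpa using congrArg (fun t ↦ TensorProduct.lid R X (f.rTensor X t))
    (tmul_comm (R := R) (m₁ := x) (m₂ := y))

variable (R X) in
theorem exists_sum_dual_apply_eq_one :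
    ∃ s : Finset (Module.Dual R X × X), ∑ i ∈ s, i.1 i.2 = 1 := by
  obtain ⟨s, hs⟩ := ((linearEquiv R X).symm 1).exists_finset
  refine ⟨s, ?_⟩
  simpa [LinearEquiv.symm_apply_eq, linearEquiv, eq_comm] using hs

theorem sum_dual_apply_smul {s : Finset (Module.Dual R X × X)} (hs : ∑ i ∈ s, i.1 i.2 = 1)
    (x : X) : ∑ i ∈ s, i.1 x • i.2 = x := by
  rw [Finset.sum_congr rfl fun i _ ↦ dual_apply_smul_comm i.1 x i.2, ← Finset.sum_smul, hs,
    one_smul]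

theorem eq_zero_of_forall_dual_apply {x : X} (hx : ∀ g : Module.Dual R X, g x = 0) : x = 0 := by
  obtain ⟨s, hs⟩ := exists_sum_dual_apply_eq_one R X
  rw [← sum_dual_apply_smul hs x]
  simp [hx]

variable {R₁ R₂ F : Type*} [CommRing R₁] [CommRing R₂] [CommRing F] {π₁ : R →+* R₁} {π₂ : R →+* R₂}

/-- The value `π₁ (g x) * f x₀` equals `f (g x₀ • x)`, which is zero, and `f x₀` can be cancelled.
-/
theorem map_dual_apply_eq_zero {f : X →ₛₗ[π₁] R₁} {x₀ x : X} (hx₀ : f x₀ ∈ R₁⁰)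
    (hx : f x = 0) (g : Module.Dual R X) : π₁ (g x) = 0 := by
  refine (mul_right_mem_nonZeroDivisors_eq_zero_iff hx₀).1 ?_
  rw [← smul_eq_mul, ← map_smulₛₗ, dual_apply_smul_comm, map_smulₛₗ, hx, smul_zero]

/-- A functional on the second component vanishes in the common quotient where the functional on
the first component vanishes. -/
theorem map_apply_eq_zero {j₁ : R₁ →+* F} {j₂ : R₂ →+* F} (comm : ∀ r, j₁ (π₁ r) = j₂ (π₂ r))
    {f₁ : X →ₛₗ[π₁] R₁} (f₂ : X →ₛₗ[π₂] R₂) {x₀ x : X} (hx₀ : f₁ x₀ ∈ R₁⁰) (hx : f₁ x = 0) :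
    j₂ (f₂ x) = 0 := by
  obtain ⟨s, hs⟩ := exists_sum_dual_apply_eq_one R X
  rw [← sum_dual_apply_smul hs x, map_sum, map_sum]
  refine Finset.sum_eq_zero fun i _ ↦ ?_
  rw [map_smulₛₗ, smul_eq_mul, map_mul, ← comm, map_dual_apply_eq_zero hx₀ hx, map_zero, zero_mul]

end Module.Invertible

/-! ### Invertible ideals containing a unit modulo a ring homomorphism -/

/-- `I` is invertible, with an inverse up to an element that becomes a unit under `j`. -/
def Ideal.InvertibleAt {S F : Type*} [CommRing S] [CommRing F] (j : S →+* F) (I : Ideal S) : Prop :=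
  ∃ (I' : Ideal S) (s : S), I * I' = Ideal.span {s} ∧ IsUnit (j s)

namespace Ideal.InvertibleAt

variable {S F : Type*} [CommRing S] [CommRing F] {j : S →+* F} {I J : Ideal S}

theorem top : Ideal.InvertibleAt j ⊤ := ⟨⊤, 1, by simp, by simp⟩

theorem mul (hI : I.InvertibleAt j) (hJ : J.InvertibleAt j) : (I * J).InvertibleAt j := by
  obtain ⟨I', s, h, hs⟩ := hI
  obtain ⟨J', t, h', ht⟩ := hJ
  exact ⟨I' * J', s * t, by rw [mul_mul_mul_comm, h, h', Ideal.span_singleton_mul_span_singleton],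
    by rw [map_mul]; exact hs.mul ht⟩

theorem exists_isUnit (hI : I.InvertibleAt j) : ∃ a ∈ I, IsUnit (j a) := by
  obtain ⟨I', s, h, hs⟩ := hI
  have hsI : s ∈ I * I' := by
    rw [h]
    exact Ideal.mem_span_singleton_self s
  exact ⟨s, Ideal.mul_le_left hsI, hs⟩

theorem exists_map_eq (hj : Function.Surjective j) (hI : I.InvertibleAt j) (c : F) :
    ∃ a ∈ I, j a = c := by
  obtain ⟨a, ha, hu⟩ := hI.exists_isUnit
  obtain ⟨b, hb⟩ := hj (c * hu.unit⁻¹)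
  exact ⟨b * a, I.mul_mem_left _ ha, by rw [map_mul, hb, mul_assoc, IsUnit.val_inv_mul, mul_one]⟩

theorem invertible (hj : ∀ s, IsUnit (j s) → s ∈ S⁰) (hI : I.InvertibleAt j) :
    Module.Invertible S I := by
  obtain ⟨I', s, h, hs⟩ := hI
  let φ := IsScalarTower.toAlgHom S S (FractionRing S)
  have hφ : Function.Injective φ := IsFractionRing.injective S (FractionRing S)
  have hu : IsUnit (Submodule.map φ.toLinearMap I) := by
    -- In the total ring of fractions `I * I'` is generated by the unit `s`, so its factor `I` is an
    -- invertible submodule.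
    refine isUnit_of_mul_isUnit_left (y := Submodule.map φ.toLinearMap I') ?_
    rw [← Submodule.map_mul]
    change IsUnit (Submodule.map φ.toLinearMap (I * I'))
    rw [h, Ideal.span, Submodule.map_span, Set.image_singleton]
    exact (IsLocalization.map_units (FractionRing S) (⟨s, hj s hs⟩ : S⁰)).map
      (Submodule.spanSingleton S)
  have : Module.Invertible S (Submodule.map φ.toLinearMap I) :=
    inferInstanceAs (Module.Invertible S hu.unit)
  exact .congr (Submodule.equivMapOfInjective φ.toLinearMap hφ I).symm

end Ideal.InvertibleAt

/-- Over a ring with a homomorphism `j` to a local ring, every invertible module is isomorphic to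
an ideal that contains a unit modulo `j`. -/
theorem Module.Invertible.exists_linearEquiv_invertibleAt {S F : Type*} [CommRing S] [CommRing F]
    [IsLocalRing F] {j : S →+* F} (hj : ∀ s, IsUnit (j s) → s ∈ S⁰)
    (X : Type*) [AddCommGroup X] [Module S X] [Module.Invertible S X] :
    ∃ I : Ideal S, I.InvertibleAt j ∧ Nonempty (X ≃ₗ[S] I) := by
  obtain ⟨s, hs⟩ := exists_sum_dual_apply_eq_one S X
  have h1 : IsUnit (∑ i ∈ s, j (i.1 i.2)) := by
    rw [← map_sum, hs, map_one]
    exact isUnit_one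
  -- Locality is used here: a sum that is a unit has a summand that is a unit. The ideal is the
  -- image of `f`, and its partner consists of the values at `x` of all functionals, since `f y * g
  -- x = g y * f x`.
  obtain ⟨⟨f, x⟩, -, hfx⟩ := IsLocalRing.exists_of_isUnit_sum h1
  refine ⟨LinearMap.range f, ⟨LinearMap.range (Module.Dual.eval S X x), f x, ?_, hfx⟩,
    ⟨LinearEquiv.ofInjective f ?_⟩⟩
  · apply le_antisymm
    · rw [Ideal.mul_le]
      rintro _ ⟨y, rfl⟩ _ ⟨g, rfl⟩
      rw [Ideal.mem_span_singleton']
      refine ⟨g y, ?_⟩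
      have := congrArg g (dual_apply_smul_comm f y x)
      simp only [map_smul, smul_eq_mul] at this
      rw [Module.Dual.eval_apply, this, mul_comm]
    · rw [Ideal.span_singleton_le_iff_mem]
      have : ∑ i ∈ s, f i.2 * i.1 x = f x := by
        conv_rhs => rw [← sum_dual_apply_smul hs x, map_sum]
        exact Finset.sum_congr rfl fun i _ ↦ by rw [map_smul, smul_eq_mul, mul_comm]
      rw [← this]
      exact sum_mem fun i _ ↦ Ideal.mul_mem_mul ⟨_, rfl⟩ ⟨i.1, rfl⟩
  · rw [injective_iff_map_eq_zero]
    intro y hy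
    refine eq_zero_of_forall_dual_apply (R := S) fun g ↦ ?_
    exact map_dual_apply_eq_zero (f := f) (hj _ hfx) hy g

/-- The induced map from `S ⊗ X` to `N` is a surjection between invertible modules, hence bijective.
-/
theorem CommRing.Pic.mapAlgebra_mk_eq {R S : Type*} [CommRing R] [CommRing S] [Algebra R S]
    {X N : Type*} [AddCommGroup X] [Module R X] [Module.Invertible R X] [AddCommGroup N]
    [Module R N] [Module S N] [IsScalarTower R S N] [Module.Invertible S N] (f : X →ₗ[R] N)
    (hf : Function.Surjective f) : Pic.mapAlgebra R S (Pic.mk R X) = Pic.mk S N := by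
  rw [Pic.mapAlgebra_apply, Pic.mk_eq_mk_iff]
  have hs : Function.Surjective (f.liftBaseChange S) := fun n ↦ by
    obtain ⟨x, rfl⟩ := hf n
    exact ⟨1 ⊗ₜ x, by simp⟩
  exact ⟨TensorProduct.AlgebraTensorModule.congr (.refl S S) (Pic.mk.linearEquiv R X) ≪≫ₗ
    .ofBijective _ (Module.Invertible.bijective_of_surjective hs)⟩

/-- A Milnor square: the ring `R` is the fibre product of `R₁` and `R₂` over `F` along the
surjections `j₁` and `j₂`. The ring `T` is a model of the product of `R₁` and `R₂`. -/
structure MilnorSquare (R T R₁ R₂ F : Type*) [CommRing R] [CommRing T] [CommRing R₁] [CommRing R₂]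
    [CommRing F] [Algebra R T] where
  p₁ : T →+* R₁
  p₂ : T →+* R₂
  j₁ : R₁ →+* F
  j₂ : R₂ →+* F
  exists_pair (x : R₁) (y : R₂) : ∃ t, p₁ t = x ∧ p₂ t = y
  ext {t u : T} : p₁ t = p₁ u → p₂ t = p₂ u → t = u
  surjective₁ : Function.Surjective j₁
  surjective₂ : Function.Surjective j₂
  injective : Function.Injective (algebraMap R T)
  comm (r : R) : j₁ (p₁ (algebraMap R T r)) = j₂ (p₂ (algebraMap R T r))
  lift (t : T) : j₁ (p₁ t) = j₂ (p₂ t) → ∃ r, algebraMap R T r = t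
  regular₁ (s : R₁) : IsUnit (j₁ s) → s ∈ R₁⁰
  regular₂ (s : R₂) : IsUnit (j₂ s) → s ∈ R₂⁰

/-! ### Glued modules over a fibre product -/

namespace MilnorSquare

variable {R T R₁ R₂ F : Type*} [CommRing R] [CommRing T] [CommRing R₁] [CommRing R₂]
    [CommRing F] [Algebra R T] (S : MilnorSquare R T R₁ R₂ F)

/-- The first projection of the fibre product. -/
def π₁ : R →+* R₁ := S.p₁.comp (algebraMap R T)

/-- The second projection of the fibre product. -/
def π₂ : R →+* R₂ := S.p₂.comp (algebraMap R T)

theorem j₁_π₁ (r : R) : S.j₁ (S.π₁ r) = S.j₂ (S.π₂ r) := S.comm r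

theorem p₁_smul (r : R) (t : T) : S.p₁ (r • t) = S.π₁ r * S.p₁ t := by
  rw [Algebra.smul_def, map_mul, π₁, RingHom.comp_apply]

theorem p₂_smul (r : R) (t : T) : S.p₂ (r • t) = S.π₂ r * S.p₂ t := by
  rw [Algebra.smul_def, map_mul, π₂, RingHom.comp_apply]

theorem exists_π_eq {x : R₁} {y : R₂} (h : S.j₁ x = S.j₂ y) :
    ∃ r, S.π₁ r = x ∧ S.π₂ r = y := by
  obtain ⟨t, rfl, rfl⟩ := S.exists_pair x y
  obtain ⟨r, rfl⟩ := S.lift t h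
  exact ⟨r, rfl, rfl⟩

theorem π₁_surjective (S : MilnorSquare R T R₁ R₂ F) : Function.Surjective S.π₁ := fun x ↦ by
  obtain ⟨y, hy⟩ := S.surjective₂ (S.j₁ x)
  obtain ⟨r, hr, -⟩ := S.exists_π_eq hy.symm
  exact ⟨r, hr⟩

theorem π₂_surjective (S : MilnorSquare R T R₁ R₂ F) : Function.Surjective S.π₂ := fun y ↦ by
  obtain ⟨x, hx⟩ := S.surjective₁ (S.j₂ y)
  obtain ⟨r, -, hr⟩ := S.exists_π_eq hx
  exact ⟨r, hr⟩

theorem eq_zero (S : MilnorSquare R T R₁ R₂ F) {r : R} (h₁ : S.π₁ r = 0) (h₂ : S.π₂ r = 0) : r = 0 :=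
  S.injective (S.ext (by rw [map_zero, map_zero]; exact h₁) (by rw [map_zero, map_zero]; exact h₂))

theorem mem_nonZeroDivisors {t : T} (h₁ : S.p₁ t ∈ R₁⁰) (h₂ : S.p₂ t ∈ R₂⁰) : t ∈ T⁰ := by
  rw [mem_nonZeroDivisors_iff_right]
  intro u hu
  refine S.ext ?_ ?_
  · rw [map_zero]
    exact (mul_right_mem_nonZeroDivisors_eq_zero_iff h₁).1 (by rw [← map_mul, hu, map_zero])
  · rw [map_zero]
    exact (mul_right_mem_nonZeroDivisors_eq_zero_iff h₂).1 (by rw [← map_mul, hu, map_zero])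

/-- The submodule of the pairs in `I₁ × I₂` that agree over `F` up to the unit `h`. -/
def glue (I₁ : Ideal R₁) (I₂ : Ideal R₂) (h : Fˣ) : Submodule R T where
  carrier := {t | S.p₁ t ∈ I₁ ∧ S.p₂ t ∈ I₂ ∧ S.j₁ (S.p₁ t) = h * S.j₂ (S.p₂ t)}
  zero_mem' := by simp
  add_mem' := by
    rintro x y ⟨hx₁, hx₂, hx⟩ ⟨hy₁, hy₂, hy⟩
    refine ⟨map_add S.p₁ x y ▸ add_mem hx₁ hy₁, map_add S.p₂ x y ▸ add_mem hx₂ hy₂, ?_⟩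
    simp only [map_add, hx, hy, mul_add]
  smul_mem' := by
    rintro c x ⟨hx₁, hx₂, hx⟩
    refine ⟨S.p₁_smul c x ▸ I₁.mul_mem_left _ hx₁, S.p₂_smul c x ▸ I₂.mul_mem_left _ hx₂, ?_⟩
    rw [S.p₁_smul, S.p₂_smul, map_mul, map_mul, hx, S.j₁_π₁]
    ring

variable {I₁ J₁ : Ideal R₁} {I₂ J₂ : Ideal R₂} {h k : Fˣ}

theorem mem_glue {t : T} : t ∈ S.glue I₁ I₂ h ↔
    S.p₁ t ∈ I₁ ∧ S.p₂ t ∈ I₂ ∧ S.j₁ (S.p₁ t) = h * S.j₂ (S.p₂ t) := Iff.rfl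

theorem exists_mem_glue₁ (hI₂ : I₂.InvertibleAt S.j₂) {x : R₁} (hx : x ∈ I₁) :
    ∃ t ∈ S.glue I₁ I₂ h, S.p₁ t = x := by
  obtain ⟨y, hy, hxy⟩ := hI₂.exists_map_eq S.surjective₂ (↑h⁻¹ * S.j₁ x)
  obtain ⟨t, rfl, rfl⟩ := S.exists_pair x y
  exact ⟨t, ⟨hx, hy, by rw [hxy, Units.mul_inv_cancel_left]⟩, rfl⟩

theorem exists_mem_glue₂ (hI₁ : I₁.InvertibleAt S.j₁) {y : R₂} (hy : y ∈ I₂) :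
    ∃ t ∈ S.glue I₁ I₂ h, S.p₂ t = y := by
  obtain ⟨x, hx, hxy⟩ := hI₁.exists_map_eq S.surjective₁ (h * S.j₂ y)
  obtain ⟨t, rfl, rfl⟩ := S.exists_pair x y
  exact ⟨t, ⟨hx, hy, hxy⟩, rfl⟩

/-- A pair `(b, 0)` with `b ∈ J₁ ∩ ker j₁` satisfies every gluing condition, and its product with a
lift of `a ∈ I₁` is `(a * b, 0)`. -/
theorem exists_mem_mul_of_mem₁ (hI₂ : I₂.InvertibleAt S.j₂) {x : R₁}
    (hx : x ∈ I₁ * (J₁ * RingHom.ker S.j₁)) :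
    ∃ t ∈ S.glue I₁ I₂ h * S.glue J₁ J₂ k, S.p₁ t = x ∧ S.p₂ t = 0 := by
  induction hx using Submodule.mul_induction_on' with
  | mem_mul_mem a ha b hb =>
    obtain ⟨t, ht, rfl⟩ := S.exists_mem_glue₁ (h := h) hI₂ ha
    obtain ⟨u, rfl, hu⟩ := S.exists_pair b 0
    refine ⟨t * u, Submodule.mul_mem_mul ht ⟨Ideal.mul_le_left hb, hu ▸ zero_mem _, ?_⟩,
      map_mul .., by rw [map_mul, hu, mul_zero]⟩
    rw [(RingHom.mem_ker).1 (Ideal.mul_le_right hb), hu, map_zero, mul_zero]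
  | add x _ y _ hx hy =>
    obtain ⟨t, ht, rfl, ht'⟩ := hx
    obtain ⟨u, hu, rfl, hu'⟩ := hy
    exact ⟨t + u, add_mem ht hu, map_add .., by rw [map_add, ht', hu', add_zero]⟩

theorem exists_mem_mul_of_mem₂ (hI₁ : I₁.InvertibleAt S.j₁) {y : R₂}
    (hy : y ∈ I₂ * (J₂ * RingHom.ker S.j₂)) :
    ∃ t ∈ S.glue I₁ I₂ h * S.glue J₁ J₂ k, S.p₁ t = 0 ∧ S.p₂ t = y := by
  induction hy using Submodule.mul_induction_on' with
  | mem_mul_mem a ha b hb =>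
    obtain ⟨t, ht, rfl⟩ := S.exists_mem_glue₂ (h := h) hI₁ ha
    obtain ⟨u, hu, rfl⟩ := S.exists_pair 0 b
    refine ⟨t * u, Submodule.mul_mem_mul ht ⟨hu ▸ zero_mem _, Ideal.mul_le_left hb, ?_⟩,
      by rw [map_mul, hu, mul_zero], map_mul ..⟩
    rw [(RingHom.mem_ker).1 (Ideal.mul_le_right hb), hu, map_zero, mul_zero]
  | add x _ y _ hx hy =>
    obtain ⟨t, ht, ht', rfl⟩ := hx
    obtain ⟨u, hu, hu', rfl⟩ := hy
    exact ⟨t + u, add_mem ht hu, by rw [map_add, ht', hu', add_zero], map_add ..⟩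

/-- Some `a ∈ I` maps to `1`, and in `x = a * x + x * (1 - a)` both terms lie in `I * ker j`. -/
theorem _root_.Ideal.InvertibleAt.mem_mul_ker {A F : Type*} [CommRing A] [CommRing F] {j : A →+* F}
    (hj : Function.Surjective j) {I : Ideal A} (hI : I.InvertibleAt j) {x : A} (hx : x ∈ I)
    (hx' : j x = 0) : x ∈ I * RingHom.ker j := by
  obtain ⟨a, ha, ha'⟩ := hI.exists_map_eq hj 1
  have : x = a * x + x * (1 - a) := by ring
  rw [this]
  exact add_mem (Ideal.mul_mem_mul ha hx')
    (Ideal.mul_mem_mul hx (by rw [RingHom.mem_ker, map_sub, ha', map_one, sub_self]))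

theorem glue_mul_glue (hI₁ : I₁.InvertibleAt S.j₁) (hI₂ : I₂.InvertibleAt S.j₂)
    (hJ₁ : J₁.InvertibleAt S.j₁) (hJ₂ : J₂.InvertibleAt S.j₂) :
    S.glue I₁ I₂ h * S.glue J₁ J₂ k = S.glue (I₁ * J₁) (I₂ * J₂) (h * k) := by
  have hle : S.glue I₁ I₂ h * S.glue J₁ J₂ k ≤ S.glue (I₁ * J₁) (I₂ * J₂) (h * k) := by
    rw [Submodule.mul_le]
    rintro t ⟨ht₁, ht₂, ht⟩ u ⟨hu₁, hu₂, hu⟩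
    refine ⟨?_, ?_, ?_⟩
    · rw [map_mul]; exact Ideal.mul_mem_mul ht₁ hu₁
    · rw [map_mul]; exact Ideal.mul_mem_mul ht₂ hu₂
    · simp only [map_mul, ht, hu, Units.val_mul]; ring
  refine le_antisymm hle fun t ht ↦ ?_
  -- One product `v * w` is arranged to have the same value in `F` as `t`. The remainder then
  -- vanishes in `F` on both sides and splits into pieces supported on a single factor.
  obtain ⟨a, ha, ha'⟩ := hI₁.exists_map_eq S.surjective₁ 1
  obtain ⟨b, hb, hb'⟩ := hJ₁.exists_map_eq S.surjective₁ (S.j₁ (S.p₁ t))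
  obtain ⟨v, hv, rfl⟩ := S.exists_mem_glue₁ (h := h) hI₂ ha
  obtain ⟨w, hw, rfl⟩ := S.exists_mem_glue₁ (h := k) hJ₂ hb
  have hvw := Submodule.mul_mem_mul hv hw
  obtain ⟨hd₁, hd₂, hd⟩ := sub_mem ht (hle hvw)
  have hz₁ : S.j₁ (S.p₁ (t - v * w)) = 0 := by
    rw [map_sub, map_sub, map_mul, map_mul, ha', hb', one_mul, sub_self]
  have hz₂ : S.j₂ (S.p₂ (t - v * w)) = 0 := by
    rwa [hz₁, eq_comm, Units.mul_right_eq_zero] at hd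
  have h₁ := (hI₁.mul hJ₁).mem_mul_ker S.surjective₁ hd₁ hz₁
  have h₂ := (hI₂.mul hJ₂).mem_mul_ker S.surjective₂ hd₂ hz₂
  rw [mul_assoc] at h₁ h₂
  obtain ⟨x, hx, hx₁, hx₂⟩ := S.exists_mem_mul_of_mem₁ (h := h) (k := k) (J₂ := J₂) hI₂ h₁
  obtain ⟨y, hy, hy₁, hy₂⟩ := S.exists_mem_mul_of_mem₂ (h := h) (k := k) (J₁ := J₁) hI₁ h₂
  have : t = v * w + (x + y) := by
    rw [← sub_eq_iff_eq_add']
    refine S.ext ?_ ?_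
    · rw [map_add, hx₁, hy₁, add_zero]
    · rw [map_add, hx₂, hy₂, zero_add]
  rw [this]
  exact add_mem hvw (add_mem hx hy)

theorem glue_span_singleton {t : T} (h₂ : IsUnit (S.j₂ (S.p₂ t)))
    (ht : S.j₁ (S.p₁ t) = h * S.j₂ (S.p₂ t)) :
    S.glue (Ideal.span {S.p₁ t}) (Ideal.span {S.p₂ t}) h = Submodule.span R {t} := by
  apply le_antisymm
  · rintro u ⟨hu₁, hu₂, hu⟩
    obtain ⟨a, ha⟩ := Ideal.mem_span_singleton'.1 hu₁
    obtain ⟨b, hb⟩ := Ideal.mem_span_singleton'.1 hu₂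
    rw [← ha, ← hb, map_mul, map_mul, ht, mul_left_comm, Units.mul_right_inj, h₂.mul_left_inj] at hu
    obtain ⟨r, rfl, rfl⟩ := S.exists_π_eq hu
    rw [Submodule.mem_span_singleton]
    refine ⟨r, S.ext ?_ ?_⟩
    · rw [S.p₁_smul, ha]
    · rw [S.p₂_smul, hb]
  · rw [Submodule.span_singleton_le_iff_mem]
    exact ⟨Ideal.mem_span_singleton_self _, Ideal.mem_span_singleton_self _, ht⟩

/-- The inclusion of `T` into its total ring of fractions. -/
abbrev toFractionRing (R T : Type*) [CommRing R] [CommRing T] [Algebra R T] :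
    T →ₐ[R] FractionRing T := IsScalarTower.toAlgHom R T (FractionRing T)

theorem faithfulSMul (S : MilnorSquare R T R₁ R₂ F) : FaithfulSMul R (FractionRing T) := by
  rw [faithfulSMul_iff_algebraMap_injective, IsScalarTower.algebraMap_eq R T (FractionRing T)]
  exact (IsFractionRing.injective T (FractionRing T)).comp S.injective

theorem isUnit_map_glue (hI₁ : I₁.InvertibleAt S.j₁) (hI₂ : I₂.InvertibleAt S.j₂) (h : Fˣ) :
    IsUnit ((S.glue I₁ I₂ h).map (toFractionRing R T).toLinearMap) := by
  obtain ⟨J₁, x, hx, hx'⟩ := id hI₁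
  obtain ⟨J₂, y, hy, hy'⟩ := id hI₂
  have hJ₁ : J₁.InvertibleAt S.j₁ := ⟨I₁, x, by rw [mul_comm, hx], hx'⟩
  have hJ₂ : J₂.InvertibleAt S.j₂ := ⟨I₂, y, by rw [mul_comm, hy], hy'⟩
  obtain ⟨t, rfl, rfl⟩ := S.exists_pair x y
  -- The gluing unit of the inverse is chosen so that the product is glued along `j₁ x / j₂ y`,
  -- which makes it free on `t = (x, y)`.
  refine isUnit_of_mul_isUnit_left (y := (S.glue J₁ J₂ (h⁻¹ * (hx'.unit * hy'.unit⁻¹))).map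
    (toFractionRing R T).toLinearMap) ?_
  rw [← Submodule.map_mul, S.glue_mul_glue hI₁ hI₂ hJ₁ hJ₂, hx, hy,
    S.glue_span_singleton hy' (by simp [mul_assoc]), Submodule.map_span, Set.image_singleton]
  exact (IsLocalization.map_units (FractionRing T)
    (⟨t, S.mem_nonZeroDivisors (S.regular₁ _ hx') (S.regular₂ _ hy')⟩ : T⁰)).map
      (Submodule.spanSingleton R)

/-- The image of a glued module in the total ring of fractions is isomorphic to it. -/
def glueEquivMap (I₁ : Ideal R₁) (I₂ : Ideal R₂) (h : Fˣ) :
    S.glue I₁ I₂ h ≃ₗ[R] (S.glue I₁ I₂ h).map (toFractionRing R T).toLinearMap :=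
  Submodule.equivMapOfInjective _ (IsFractionRing.injective T (FractionRing T)) _

theorem invertible_glue (hI₁ : I₁.InvertibleAt S.j₁) (hI₂ : I₂.InvertibleAt S.j₂) (h : Fˣ) :
    Module.Invertible R (S.glue I₁ I₂ h) := by
  have := S.faithfulSMul
  have : Module.Invertible R ((S.glue I₁ I₂ h).map (toFractionRing R T).toLinearMap) :=
    inferInstanceAs (Module.Invertible R (S.isUnit_map_glue hI₁ hI₂ h).unit)
  exact .congr (S.glueEquivMap I₁ I₂ h).symm

/-- The class of a glued module in the Picard group. -/
def picGlue (hI₁ : I₁.InvertibleAt S.j₁) (hI₂ : I₂.InvertibleAt S.j₂) (h : Fˣ) : Pic R :=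
  have := S.invertible_glue hI₁ hI₂ h
  Pic.mk R (S.glue I₁ I₂ h)

theorem picGlue_eq_iff {hI₁ : I₁.InvertibleAt S.j₁} {hI₂ : I₂.InvertibleAt S.j₂} {h : Fˣ}
    {X : Pic R} : S.picGlue hI₁ hI₂ h = X ↔ Nonempty (X ≃ₗ[R] S.glue I₁ I₂ h) := by
  have := S.invertible_glue hI₁ hI₂ h
  exact Pic.mk_eq_iff.trans ⟨fun ⟨e⟩ ↦ ⟨e.symm⟩, fun ⟨e⟩ ↦ ⟨e.symm⟩⟩

theorem picGlue_mul (hI₁ : I₁.InvertibleAt S.j₁) (hI₂ : I₂.InvertibleAt S.j₂)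
    (hJ₁ : J₁.InvertibleAt S.j₁) (hJ₂ : J₂.InvertibleAt S.j₂) (h k : Fˣ) :
    S.picGlue hI₁ hI₂ h * S.picGlue hJ₁ hJ₂ k =
      S.picGlue (hI₁.mul hJ₁) (hI₂.mul hJ₂) (h * k) := by
  have := S.faithfulSMul
  -- Inside the total ring of fractions the class comes from the homomorphism `unitsToPic`, so
  -- products of classes become products of submodules.
  have key {K₁ : Ideal R₁} {K₂ : Ideal R₂} (hK₁ : K₁.InvertibleAt S.j₁)
      (hK₂ : K₂.InvertibleAt S.j₂) (l : Fˣ) : S.picGlue hK₁ hK₂ l =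
      Submodule.unitsToPic R (FractionRing T) (S.isUnit_map_glue hK₁ hK₂ l).unit :=
    S.picGlue_eq_iff.2 ⟨(Submodule.unitsToPicEquiv (S.isUnit_map_glue hK₁ hK₂ l).unit).trans
      (S.glueEquivMap K₁ K₂ l).symm⟩
  rw [key, key, key, ← map_mul]
  congr 1
  refine Units.ext ?_
  rw [Units.val_mul, IsUnit.unit_spec, IsUnit.unit_spec, IsUnit.unit_spec, ← Submodule.map_mul,
    S.glue_mul_glue hI₁ hI₂ hJ₁ hJ₂]

/-- Triviality means being free on one element `t`. Since the glued module surjects onto both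
ideals, the coordinates of `t` generate them. -/
theorem picGlue_eq_one_iff (hI₁ : I₁.InvertibleAt S.j₁) (hI₂ : I₂.InvertibleAt S.j₂) (h : Fˣ) :
    S.picGlue hI₁ hI₂ h = 1 ↔
      ∃ x y, I₁ = Ideal.span {x} ∧ I₂ = Ideal.span {y} ∧ S.j₁ x = h * S.j₂ y := by
  have := S.invertible_glue hI₁ hI₂ h
  rw [picGlue, Pic.mk_eq_one_iff]
  constructor
  · rintro ⟨e⟩
    obtain ⟨t, ht, hspan⟩ : ∃ t ∈ S.glue I₁ I₂ h, S.glue I₁ I₂ h = Submodule.span R {t} := by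
      refine ⟨e.symm 1, (e.symm 1).2, le_antisymm (fun u hu ↦ ?_) ?_⟩
      · rw [Submodule.mem_span_singleton]
        refine ⟨e ⟨u, hu⟩, ?_⟩
        rw [← Submodule.coe_smul, ← map_smul, smul_eq_mul, mul_one, e.symm_apply_apply]
      · rw [Submodule.span_singleton_le_iff_mem]
        exact (e.symm 1).2
    refine ⟨S.p₁ t, S.p₂ t, ?_, ?_, ht.2.2⟩
    · refine le_antisymm (fun x hx ↦ ?_) ((Ideal.span_singleton_le_iff_mem _).2 ht.1)
      obtain ⟨u, hu, rfl⟩ := S.exists_mem_glue₁ (h := h) hI₂ hx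
      rw [hspan] at hu
      obtain ⟨r, rfl⟩ := Submodule.mem_span_singleton.1 hu
      rw [S.p₁_smul]
      exact Ideal.mul_mem_left _ _ (Ideal.mem_span_singleton_self _)
    · refine le_antisymm (fun x hx ↦ ?_) ((Ideal.span_singleton_le_iff_mem _).2 ht.2.1)
      obtain ⟨u, hu, rfl⟩ := S.exists_mem_glue₂ (h := h) hI₁ hx
      rw [hspan] at hu
      obtain ⟨r, rfl⟩ := Submodule.mem_span_singleton.1 hu
      rw [S.p₂_smul]
      exact Ideal.mul_mem_left _ _ (Ideal.mem_span_singleton_self _)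
  · rintro ⟨x, y, rfl, rfl, hxy⟩
    obtain ⟨a, ha, hu⟩ := hI₁.exists_isUnit
    have hx : IsUnit (S.j₁ x) := by
      obtain ⟨b, rfl⟩ := Ideal.mem_span_singleton'.1 ha
      rw [map_mul] at hu
      exact isUnit_of_mul_isUnit_right hu
    have hy : IsUnit (S.j₂ y) := by
      rw [hxy] at hx
      exact isUnit_of_mul_isUnit_right hx
    obtain ⟨t, rfl, rfl⟩ := S.exists_pair x y
    have ht := S.mem_nonZeroDivisors (S.regular₁ _ hx) (S.regular₂ _ hy)
    refine ⟨((LinearEquiv.ofInjective (LinearMap.toSpanSingleton R T t) fun r s hrs ↦ ?_).trans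
      (LinearEquiv.ofEq _ _ ?_)).symm⟩
    · simp only [LinearMap.toSpanSingleton_apply, Algebra.smul_def] at hrs
      exact S.injective ((mul_cancel_right_mem_nonZeroDivisors ht).1 hrs)
    · rw [S.glue_span_singleton hy hxy, LinearMap.range_toSpanSingleton]

theorem mapRingHom_picGlue (hI₁ : I₁.InvertibleAt S.j₁) (hI₂ : I₂.InvertibleAt S.j₂) (h : Fˣ) :
    haveI := hI₂.invertible S.regular₂
    Pic.mapRingHom S.π₂ (S.picGlue hI₁ hI₂ h) = Pic.mk R₂ I₂ := by
  have := hI₂.invertible S.regular₂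
  have := S.invertible_glue hI₁ hI₂ h
  let := S.π₂.toAlgebra
  let f : S.glue I₁ I₂ h →ₗ[R] I₂ :=
    { toFun := fun t ↦ ⟨S.p₂ t, t.2.2.1⟩
      map_add' := fun t u ↦ Subtype.ext (map_add S.p₂ t.1 u.1)
      map_smul' := fun r t ↦ Subtype.ext ((S.p₂_smul r t.1).trans (Algebra.smul_def r _).symm) }
  refine Pic.mapAlgebra_mk_eq f fun y ↦ ?_
  obtain ⟨t, ht, hty⟩ := S.exists_mem_glue₂ (h := h) hI₁ y.2
  exact ⟨⟨t, ht⟩, Subtype.ext hty⟩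

/-! ### Every invertible module is glued -/

section Classification

variable {X : Type*} [AddCommGroup X] [Module R X]
  {f₁ : X →ₛₗ[S.π₁] R₁} {f₂ : X →ₛₗ[S.π₂] R₂}

/-- The pairs `(0, f₂ x)` and `(0, 1 - f₂ a)` agree in `F`, so they come from scalars `r`, `s` of
`R`, and `r • a + s • x` has the two required values. -/
theorem exists_apply_eq_zero {a : X} (ha : S.j₂ (f₂ a) = 1) {x : X} (hx : S.j₂ (f₂ x) = 0) :
    ∃ z, f₁ z = 0 ∧ f₂ z = f₂ x := by
  obtain ⟨r, hr₁, hr₂⟩ := S.exists_π_eq (x := 0) (y := f₂ x) (by rw [map_zero, hx])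
  obtain ⟨s, hs₁, hs₂⟩ := S.exists_π_eq (x := 0) (y := 1 - f₂ a)
    (by rw [map_zero, map_sub, map_one, ha, sub_self])
  refine ⟨r • a + s • x, ?_, ?_⟩
  · simp only [map_add, map_smulₛₗ, smul_eq_mul, hr₁, hs₁, zero_mul, add_zero]
  · simp only [map_add, map_smulₛₗ, smul_eq_mul, hr₂, hs₂]
    ring

variable [Module.Invertible R X]

theorem apply_injective {x₀ y₀ : X} (hx₀ : IsUnit (S.j₁ (f₁ x₀))) (hy₀ : IsUnit (S.j₂ (f₂ y₀)))
    {x : X} (h₁ : f₁ x = 0) (h₂ : f₂ x = 0) : x = 0 :=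
  Module.Invertible.eq_zero_of_forall_dual_apply (R := R) fun g ↦ S.eq_zero
    (Module.Invertible.map_dual_apply_eq_zero (S.regular₁ _ hx₀) h₁ g)
    (Module.Invertible.map_dual_apply_eq_zero (S.regular₂ _ hy₀) h₂ g)

/-- The maps `j₁ ∘ f₁` and `j₂ ∘ f₂` to `F` differ by a unit, which becomes the gluing unit `h`. The
isomorphism is `x ↦ (f₁ x, f₂ x)`. -/
theorem exists_linearEquiv_glue_of_apply (hI₁ : Set.range f₁ = I₁)
    (hI₂ : Set.range f₂ = I₂) {x₀ y₀ : X} (hx₀ : IsUnit (S.j₁ (f₁ x₀)))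
    (hy₀ : IsUnit (S.j₂ (f₂ y₀))) : ∃ h : Fˣ, Nonempty (X ≃ₗ[R] S.glue I₁ I₂ h) := by
  obtain ⟨a, ha⟩ : ∃ a, S.j₂ (f₂ a) = 1 := by
    obtain ⟨y, hy⟩ := S.surjective₂ ↑hy₀.unit⁻¹
    obtain ⟨r, rfl⟩ := S.π₂_surjective y
    exact ⟨r • y₀, by rw [map_smulₛₗ, smul_eq_mul, map_mul, hy, IsUnit.val_inv_mul]⟩
  -- Subtracting `z` does not change `f₁ x` and makes the second coordinate exactly zero, so that
  -- `map_apply_eq_zero` applies.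
  have hker {x : X} (hx : S.j₂ (f₂ x) = 0) : S.j₁ (f₁ x) = 0 := by
    obtain ⟨z, hz₁, hz₂⟩ := S.exists_apply_eq_zero (f₁ := f₁) ha hx
    have : S.j₁ (f₁ (x - z)) = 0 :=
      Module.Invertible.map_apply_eq_zero (fun r ↦ (S.j₁_π₁ r).symm) f₁ (S.regular₂ _ hy₀)
        (x := x - z) (by rw [map_sub, hz₂, sub_self])
    rwa [map_sub, hz₁, sub_zero] at this
  have hmul (x : X) : S.j₁ (f₁ x) = S.j₁ (f₁ a) * S.j₂ (f₂ x) := by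
    obtain ⟨r, hr⟩ := S.π₂_surjective (f₂ x)
    have h0 := hker (x := x - r • a) (by
      rw [map_sub, map_smulₛₗ, smul_eq_mul, hr, map_sub, map_mul, ha, mul_one, sub_self])
    rw [map_sub, map_smulₛₗ, smul_eq_mul, map_sub, map_mul, S.j₁_π₁, hr, sub_eq_zero] at h0
    rw [h0, mul_comm]
  have hu : IsUnit (S.j₁ (f₁ a)) := by
    rw [hmul x₀] at hx₀
    exact isUnit_of_mul_isUnit_left hx₀
  choose P hP₁ hP₂ using fun x ↦ S.exists_pair (f₁ x) (f₂ x)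
  let Φ : X →ₗ[R] S.glue I₁ I₂ hu.unit :=
    { toFun := fun x ↦ ⟨P x, by
        rw [mem_glue, hP₁, hP₂]
        exact ⟨hI₁.subset ⟨x, rfl⟩, hI₂.subset ⟨x, rfl⟩, hmul x⟩⟩
      map_add' := fun x y ↦ Subtype.ext <| S.ext (by simp [hP₁]) (by simp [hP₂])
      map_smul' := fun r x ↦ Subtype.ext <| S.ext (by simp [hP₁, S.p₁_smul])
        (by simp [hP₂, S.p₂_smul]) }
  refine ⟨hu.unit, ⟨LinearEquiv.ofBijective Φ ⟨?_, ?_⟩⟩⟩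
  · rw [injective_iff_map_eq_zero]
    intro x hx
    have hx : P x = 0 := congrArg Subtype.val hx
    exact S.apply_injective hx₀ hy₀ (by rw [← hP₁, hx, map_zero]) (by rw [← hP₂, hx, map_zero])
  · rintro ⟨t, ht₁, ht₂, ht⟩
    obtain ⟨x, hx⟩ := hI₁.superset ht₁
    obtain ⟨y, hy⟩ := hI₂.superset ht₂
    -- The element `x` has the right first coordinate. The error in the second one vanishes in `F`,
    -- so it can be corrected without touching the first.
    have h0 : S.j₂ (f₂ (y - x)) = 0 := by
      rw [← hx, hmul x, IsUnit.unit_spec, hu.mul_right_inj, ← hy] at ht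
      rw [map_sub, map_sub, ht, sub_self]
    obtain ⟨z, hz₁, hz₂⟩ := S.exists_apply_eq_zero (f₁ := f₁) ha h0
    refine ⟨x + z, Subtype.ext (S.ext ?_ ?_)⟩
    · change S.p₁ (P (x + z)) = S.p₁ t
      rw [hP₁, map_add, hz₁, add_zero, hx]
    · change S.p₂ (P (x + z)) = S.p₂ t
      rw [hP₂, map_add, hz₂, map_sub, add_sub_cancel, hy]

/-- An isomorphism of a base change with an ideal, as a linear map with that ideal as image. -/
theorem exists_linearMap_range_eq {R A X : Type*} [CommRing R] [CommRing A] [Algebra R A]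
    (hA : Function.Surjective (algebraMap R A)) [AddCommGroup X] [Module R X] {I : Ideal A}
    (e : TensorProduct R A X ≃ₗ[A] I) : 
    ∃ f : X →ₛₗ[algebraMap R A] A, Set.range f = I := by
  refine ⟨{ toFun := fun x ↦ e (1 ⊗ₜ x)
            map_add' := fun x y ↦ by rw [TensorProduct.tmul_add, map_add, Submodule.coe_add]
            map_smul' := fun r x ↦ by
              rw [← TensorProduct.smul_tmul, ← Algebra.algebraMap_eq_smul_one,
                ← mul_one (algebraMap R A r), ← smul_eq_mul, ← TensorProduct.smul_tmul', map_smul,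
                Submodule.coe_smul, smul_eq_mul, smul_eq_mul, smul_eq_mul, mul_one] }, ?_⟩
  ext a
  constructor
  · rintro ⟨x, rfl⟩
    exact (e _).2
  · intro ha
    obtain ⟨t, ht⟩ := e.surjective ⟨a, ha⟩
    -- Scalars of `A` lift to `R`, so every tensor is pure with left factor `1`.
    have : ∃ x, t = (1 : A) ⊗ₜ x := by
      clear ht
      induction t using TensorProduct.induction_on with
      | zero => exact ⟨0, by simp⟩
      | tmul b x =>
        obtain ⟨r, rfl⟩ := hA b
        exact ⟨r • x, by rw [Algebra.algebraMap_eq_smul_one, TensorProduct.smul_tmul]⟩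
      | add t u ht hu =>
        obtain ⟨x, rfl⟩ := ht
        obtain ⟨y, rfl⟩ := hu
        exact ⟨x + y, by rw [TensorProduct.tmul_add]⟩
    obtain ⟨x, rfl⟩ := this
    exact ⟨x, congrArg Subtype.val ht⟩

theorem exists_linearEquiv_glue (hI₁ : I₁.InvertibleAt S.j₁) (hI₂ : I₂.InvertibleAt S.j₂)
    (h₁ : letI := S.π₁.toAlgebra; Nonempty (TensorProduct R R₁ X ≃ₗ[R₁] I₁))
    (h₂ : letI := S.π₂.toAlgebra; Nonempty (TensorProduct R R₂ X ≃ₗ[R₂] I₂)) :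
    ∃ h : Fˣ, Nonempty (X ≃ₗ[R] S.glue I₁ I₂ h) := by
  obtain ⟨f₁, hf₁⟩ : ∃ f₁ : X →ₛₗ[S.π₁] R₁, Set.range f₁ = I₁ := by
    let := S.π₁.toAlgebra
    exact h₁.elim fun e ↦ exists_linearMap_range_eq S.π₁_surjective e
  obtain ⟨f₂, hf₂⟩ : ∃ f₂ : X →ₛₗ[S.π₂] R₂, Set.range f₂ = I₂ := by
    let := S.π₂.toAlgebra
    exact h₂.elim fun e ↦ exists_linearMap_range_eq S.π₂_surjective e
  obtain ⟨a, ha, hau⟩ := hI₁.exists_isUnit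
  obtain ⟨b, hb, hbu⟩ := hI₂.exists_isUnit
  obtain ⟨x₀, rfl⟩ := hf₁.superset ha
  obtain ⟨y₀, rfl⟩ := hf₂.superset hb
  exact S.exists_linearEquiv_glue_of_apply hf₁ hf₂ hau hbu

end Classification

theorem exists_picGlue_eq [IsLocalRing F] (X : Pic R) :
    ∃ (I₁ : Ideal R₁) (I₂ : Ideal R₂) (hI₁ : I₁.InvertibleAt S.j₁) (hI₂ : I₂.InvertibleAt S.j₂)
      (h : Fˣ), S.picGlue hI₁ hI₂ h = X := by
  obtain ⟨I₁, hI₁, h₁⟩ : letI := S.π₁.toAlgebra; ∃ I₁ : Ideal R₁, I₁.InvertibleAt S.j₁ ∧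
      Nonempty (TensorProduct R R₁ X ≃ₗ[R₁] I₁) := by
    let := S.π₁.toAlgebra
    exact Module.Invertible.exists_linearEquiv_invertibleAt S.regular₁ _
  obtain ⟨I₂, hI₂, h₂⟩ : letI := S.π₂.toAlgebra; ∃ I₂ : Ideal R₂, I₂.InvertibleAt S.j₂ ∧
      Nonempty (TensorProduct R R₂ X ≃ₗ[R₂] I₂) := by
    let := S.π₂.toAlgebra
    exact Module.Invertible.exists_linearEquiv_invertibleAt S.regular₂ _
  obtain ⟨h, ⟨e⟩⟩ := S.exists_linearEquiv_glue hI₁ hI₂ h₁ h₂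
  exact ⟨I₁, I₂, hI₁, hI₂, h, S.picGlue_eq_iff.2 ⟨e⟩⟩

/-- If every unit of the common quotient lifts to a unit of `R₂` and `Pic R₁` is trivial, then
`Pic R` maps isomorphically to `Pic R₂`. -/
theorem mapRingHom_bijective [IsLocalRing F] [Subsingleton (Pic R₁)]
    (hu : ∀ h : Fˣ, ∃ u : R₂ˣ, S.j₂ u = h) : Function.Bijective (Pic.mapRingHom S.π₂) := by
  constructor
  · rw [injective_iff_map_eq_one]
    intro X hX
    have h₁ : letI := S.π₁.toAlgebra; Nonempty (TensorProduct R R₁ X ≃ₗ[R₁] (⊤ : Ideal R₁)) := by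
      let := S.π₁.toAlgebra
      exact (Pic.mk_eq_one_iff.1 (Subsingleton.elim (Pic.mk R₁ (TensorProduct R R₁ X)) 1)).map
        (·.trans Submodule.topEquiv.symm)
    have h₂ : letI := S.π₂.toAlgebra; Nonempty (TensorProduct R R₂ X ≃ₗ[R₂] (⊤ : Ideal R₂)) := by
      let := S.π₂.toAlgebra
      exact (Pic.mk_eq_one_iff.1 hX).map (·.trans Submodule.topEquiv.symm)
    obtain ⟨h, ⟨e⟩⟩ := S.exists_linearEquiv_glue .top .top h₁ h₂
    obtain ⟨u, huh⟩ := hu h⁻¹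
    rw [← (S.picGlue_eq_iff (hI₁ := .top) (hI₂ := .top)).2 ⟨e⟩, picGlue_eq_one_iff]
    -- The generator `(1, u)` works because `u` reduces to `h⁻¹`.
    exact ⟨1, u, by simp, (Ideal.span_singleton_eq_top.2 u.isUnit).symm, by rw [huh]; simp⟩
  · intro Y
    obtain ⟨I, hI, ⟨e⟩⟩ := Module.Invertible.exists_linearEquiv_invertibleAt S.regular₂ Y
    have := hI.invertible S.regular₂
    refine ⟨S.picGlue .top hI 1, ?_⟩
    rw [mapRingHom_picGlue]
    exact Pic.mk_eq_iff.2 ⟨e.symm⟩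

end MilnorSquare

/-! ### The norm form of `X ^ p - z` modulo `p` -/

section NormForm

open Polynomial Matrix

/-- The companion matrix of `X ^ p - z`. -/
def shiftMatrix {R : Type*} [CommRing R] (p : ℕ) (z : R) : Matrix (Fin p) (Fin p) R :=
  .of fun i j ↦ if (i : ℕ) = j + 1 then 1 else if (i : ℕ) + p = j + 1 then z else 0

variable {R : Type*} [CommRing R] {p : ℕ}

/-- The matrix moves the basis vectors cyclically, with a factor `z` at the wrap. For `k ≤ p` at
most one wrap occurs, hence the two cases. -/
theorem shiftMatrix_pow_apply (z : R) {k : ℕ} (hk : k ≤ p) (i j : Fin p) :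
    (shiftMatrix p z ^ k) i j =
      if (i : ℕ) = j + k then 1 else if (i : ℕ) + p = j + k then z else 0 := by
  have hi := i.2
  have hj := j.2
  induction k generalizing j with
  | zero =>
    rw [pow_zero, Matrix.one_apply, if_neg (c := (i : ℕ) + p = j + 0) (by omega)]
    simp [Fin.ext_iff]
  | succ k ih =>
    rw [pow_succ, Matrix.mul_apply]
    by_cases hj' : (j : ℕ) + 1 = p
    · rw [Finset.sum_eq_single (⟨0, by omega⟩ : Fin p), ih (by omega) _ (by simp; omega)]
      · simp only [shiftMatrix, Matrix.of_apply]
        split_ifs <;> simp at * <;> omega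
      · intro l _ hl
        have hl2 := l.2
        have hl' : (l : ℕ) ≠ 0 := fun h ↦ hl (Fin.ext h)
        simp only [shiftMatrix, Matrix.of_apply]
        rw [if_neg (by omega), if_neg (by omega), mul_zero]
      · simp
    · rw [Finset.sum_eq_single (⟨j + 1, by omega⟩ : Fin p), ih (by omega) _ (by simp; omega)]
      · simp only [shiftMatrix, Matrix.of_apply, if_true, mul_one]
        rw [add_assoc, add_comm 1 k]
      · intro l _ hl
        have hl2 := l.2
        have hl' : (l : ℕ) ≠ j + 1 := fun h ↦ hl (Fin.ext h)
        simp only [shiftMatrix, Matrix.of_apply]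
        rw [if_neg (by omega), if_neg (by omega), mul_zero]
      · simp

theorem shiftMatrix_pow_self (z : R) :
    shiftMatrix p z ^ p = algebraMap R (Matrix (Fin p) (Fin p) R) z := by
  ext i j
  have hi := i.2
  rw [shiftMatrix_pow_apply z le_rfl, if_neg (by omega), Matrix.algebraMap_matrix_apply]
  simp [Fin.ext_iff]

theorem map_shiftMatrix {S : Type*} [CommRing S] (f : R →+* S) (z : R) :
    f.mapMatrix (shiftMatrix p z) = shiftMatrix p (f z) := by
  ext i j
  simp only [shiftMatrix, RingHom.mapMatrix_apply, Matrix.map_apply, Matrix.of_apply]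
  split_ifs <;> simp

/-- Evaluation along `Int.castRingHom` depends on no chosen `ℤ`-algebra structure, so it commutes
with all ring homomorphisms. -/
theorem eval₂_intCast_eq_aeval {A : Type*} [Ring A] [Algebra ℤ A] (a : A) (P : ℤ[X]) :
    P.eval₂ (Int.castRingHom A) a = aeval a P := by
  rw [aeval_def, RingHom.ext_int (algebraMap ℤ A)]

theorem map_eval₂_intCast {A B : Type*} [Ring A] [Ring B] (f : A →+* B) (a : A) (P : ℤ[X]) :
    f (P.eval₂ (Int.castRingHom A) a) = P.eval₂ (Int.castRingHom B) (f a) := by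
  rw [hom_eval₂, RingHom.ext_int (f.comp _)]

theorem map_aeval_int {A B : Type*} [Ring A] [Ring B] [Algebra ℤ A] [Algebra ℤ B] (f : A →+* B)
    (a : A) (P : ℤ[X]) : f (aeval a P) = aeval (f a) P := by
  rw [← eval₂_intCast_eq_aeval, ← eval₂_intCast_eq_aeval, map_eval₂_intCast]

/-- The norm form of `X ^ p - z`, evaluated at an integral polynomial. -/
def shiftNorm (p : ℕ) (z : R) (P : ℤ[X]) : R :=
  (P.eval₂ (Int.castRingHom _) (shiftMatrix p z)).det

theorem map_shiftNorm {S : Type*} [CommRing S] (f : R →+* S) (z : R) (P : ℤ[X]) :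
    f (shiftNorm p z P) = shiftNorm p (f z) P := by
  rw [shiftNorm, RingHom.map_det, map_eval₂_intCast, map_shiftMatrix, shiftNorm]

/-- With `S` the shift matrix, `P(S) ^ p = P(S ^ p) = P(X) • 1` in characteristic `p`, so both sides
have the same `p`-th power. Frobenius is injective on `(ZMod p)[X]`; this is why a generic parameter
is treated first and specialised in `shiftNorm_eq_aeval`. -/
theorem shiftNorm_X [Fact p.Prime] (P : ℤ[X]) :
    shiftNorm p (X : (ZMod p)[X]) P = P.map (Int.castRingHom (ZMod p)) := by
  have hP {A : Type} [Ring A] [Algebra (ZMod p) A] (a : A) :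
      P.eval₂ (Int.castRingHom A) a = aeval a (P.map (Int.castRingHom (ZMod p))) := by
    rw [aeval_def, eval₂_map, RingHom.ext_int (Int.castRingHom A)]
  apply frobenius_inj (ZMod p)[X] p
  rw [frobenius_def, frobenius_def, shiftNorm, ← Matrix.det_pow, hP, ← map_pow, ← ZMod.expand_card,
    expand_aeval, shiftMatrix_pow_self, aeval_algebraMap_apply, Matrix.algebraMap_eq_diagonal,
    Matrix.det_diagonal]
  simp [ZMod.expand_card]

theorem shiftNorm_eq_aeval [Fact p.Prime] (hp : (p : R) = 0) (z : R) (P : ℤ[X]) :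
    shiftNorm p z P = aeval z P := by
  nontriviality R
  have : CharP R p := (CharP.charP_iff_prime_eq_zero Fact.out).2 hp
  have h := congrArg (eval₂RingHom (ZMod.castHom dvd_rfl R) z) (shiftNorm_X (p := p) P)
  rw [map_shiftNorm] at h
  simp only [coe_eval₂RingHom, eval₂_X, eval₂_map] at h
  rw [h, ← eval₂_intCast_eq_aeval, RingHom.ext_int (Int.castRingHom R)]

/-- The norm of an element of a radical extension of degree `p`. -/
theorem norm_aeval_eq_shiftNorm {K L : Type*} [Field K] [Field L] [Algebra K L] {z : K}
    {t : L} (ht : t ^ p = algebraMap K L z) (b : Module.Basis (Fin p) K L)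
    (hb : ∀ i, b i = t ^ (i : ℕ)) (P : ℤ[X]) :
    Algebra.norm K (aeval t P) = shiftNorm p z P := by
  have key : Algebra.leftMulMatrix b t = shiftMatrix p z := by
    ext i j
    have hj := j.2
    rw [Algebra.leftMulMatrix_eq_repr_mul, hb, ← pow_succ']
    simp only [shiftMatrix, Matrix.of_apply]
    have hi := i.2
    by_cases hj' : (j : ℕ) + 1 = p
    · have h0 : t ^ ((j : ℕ) + 1) = z • b ⟨0, by omega⟩ := by
        rw [hj', ht, hb, pow_zero, Algebra.algebraMap_eq_smul_one]
      rw [h0, map_smul, b.repr_self, if_neg (by omega), Finsupp.smul_apply,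
        Finsupp.single_apply]
      simp only [Fin.ext_iff, smul_eq_mul, mul_ite, mul_one, mul_zero]
      exact if_congr (by omega) rfl rfl
    · have h0 : t ^ ((j : ℕ) + 1) = b ⟨j + 1, by omega⟩ := by rw [hb]
      rw [h0, b.repr_self, if_neg (c := (i : ℕ) + p = j + 1) (by omega), Finsupp.single_apply]
      simp only [Fin.ext_iff, eq_comm]
  rw [Algebra.norm_eq_matrix_det b, shiftNorm, ← key, ← eval₂_intCast_eq_aeval]
  exact congrArg Matrix.det (map_eval₂_intCast (Algebra.leftMulMatrix b).toRingHom t P)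

end NormForm

/-! ### Quotients generated by a root of unity of `p`-power order -/

section Local

open Polynomial

/-- In characteristic `p` the element `z - 1` is nilpotent, so `P(z)` differs by a nilpotent from
the integer `P(1)`, which is zero or a unit modulo `p`. -/
theorem isUnit_or_isNilpotent_aeval {R : Type*} [CommRing R] {p k : ℕ} [Fact p.Prime]
    (hp : (p : R) = 0) {z : R} (hz : z ^ p ^ k = 1) (P : ℤ[X]) :
    IsUnit (aeval z P) ∨ IsNilpotent (aeval z P) := by
  nontriviality R
  have : CharP R p := (CharP.charP_iff_prime_eq_zero Fact.out).2 hp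
  have hnil : IsNilpotent (z - 1) := ⟨p ^ k, by rw [sub_pow_char_pow, hz, one_pow, sub_self]⟩
  obtain ⟨c, hc⟩ : z - 1 ∣ aeval z P - (P.eval 1 : ℤ) := by
    have := (P.map (Int.castRingHom R)).sub_dvd_eval_sub z 1
    rwa [eval_map, eval_map, eval₂_at_one, ← algebraMap_int_eq, ← aeval_def] at this
  have hn : IsNilpotent (aeval z P - ((P.eval 1 : ℤ) : R)) := by
    rw [hc]
    exact (Commute.all _ _).isNilpotent_mul_right hnil
  have hdec : aeval z P = (aeval z P - ((P.eval 1 : ℤ) : R)) + ((P.eval 1 : ℤ) : R) := by ring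
  by_cases hd : (p : ℤ) ∣ P.eval 1
  · right
    have h0 : ((P.eval 1 : ℤ) : R) = 0 := (CharP.intCast_eq_zero_iff R p _).2 hd
    rwa [h0, sub_zero] at hn
  · left
    rw [hdec]
    refine hn.isUnit_add_right_of_commute ?_ (Commute.all _ _)
    have hco : IsCoprime (p : ℤ) (P.eval 1) :=
      ((Nat.prime_iff_prime_int.1 Fact.out).coprime_iff_not_dvd).2 hd
    obtain ⟨a, b, hab⟩ := hco
    refine IsUnit.of_mul_eq_one (b : R) ?_
    have := congrArg (Int.cast : ℤ → R) hab
    push_cast at this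
    rw [hp, mul_zero, zero_add, mul_comm] at this
    exact this

theorem isLocalRing_of_isUnit_or_isNilpotent {R : Type*} [CommRing R] [Nontrivial R]
    (h : ∀ a : R, IsUnit a ∨ IsNilpotent a) : IsLocalRing R :=
  .of_isUnit_or_isUnit_one_sub_self fun a ↦ (h a).imp_right fun ha ↦ ha.isUnit_one_sub

end Local

/-! ### Cyclotomic integers modulo `p` -/

namespace CyclicPic

open Polynomial

theorem natCast_quotient (R : Type*) [CommRing R] (p : ℕ) : ((p : ℕ) : R ⧸ pIdeal p R) = 0 := by
  rw [← map_natCast (Ideal.Quotient.mk (pIdeal p R)), Ideal.Quotient.eq_zero_iff_mem]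
  exact Ideal.mem_span_singleton_self _

theorem j₁_natCast (p : ℕ) (K : Type*) [Field K] [NumberField K] : j₁ p K p = 0 := by
  rw [map_natCast]
  exact natCast_quotient _ _

theorem j₁_surjective (p : ℕ) (K : Type*) [Field K] [NumberField K] : Function.Surjective (j₁ p K) := Ideal.Quotient.mk_surjective

variable {p : ℕ} [Fact p.Prime] {K : Type*} [Field K] [NumberField K]
  {L : Type*} [Field L] [NumberField L]

theorem exists_aeval_toInteger {n : ℕ} [NeZero n] [IsCyclotomicExtension {n} ℚ K] {ζ : K}
    (h : IsPrimitiveRoot ζ n) (x : 𝓞 K) : ∃ P : ℤ[X], aeval h.toInteger P = x := by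
  obtain ⟨P, hP⟩ := h.integralPowerBasis.exists_eq_aeval' x
  exact ⟨P, by rw [hP, h.integralPowerBasis_gen]⟩

theorem isUnit_or_isNilpotent_quotient {k : ℕ} [IsCyclotomicExtension {p ^ k} ℚ K] {ζ : K}
    (h : IsPrimitiveRoot ζ (p ^ k)) (a : 𝓞 K ⧸ pIdeal p (𝓞 K)) : IsUnit a ∨ IsNilpotent a := by
  obtain ⟨x, rfl⟩ := Ideal.Quotient.mk_surjective a
  obtain ⟨P, rfl⟩ := exists_aeval_toInteger h x
  rw [map_aeval_int]
  refine isUnit_or_isNilpotent_aeval (k := k) (natCast_quotient _ p) ?_ P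
  rw [← map_pow, h.toInteger_isPrimitiveRoot.pow_eq_one, map_one]

instance nontrivial_F : Nontrivial (F p K) := by
  refine Ideal.Quotient.nontrivial_iff.2 fun h ↦ ?_
  have h0 : PrimeTo p (⊥ : Ideal (𝓞 K)) := by
    rw [PrimeTo, h, ← Ideal.one_eq_top]
    exact isCoprime_one_right
  have h1 := PrimeTo.ne_zero h0
  rw [FractionalIdeal.coeIdeal_bot] at h1
  exact h1 rfl

theorem isLocalRing_F [IsCyclotomicExtension {p} ℚ K] {ζ₁ : K} (h₁ : IsPrimitiveRoot ζ₁ p) :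
    IsLocalRing (F p K) := by
  have : IsCyclotomicExtension {p ^ 1} ℚ K := by rwa [pow_one]
  exact isLocalRing_of_isUnit_or_isNilpotent
    (isUnit_or_isNilpotent_quotient (k := 1) (by rwa [pow_one]))

/-- Only `j p = 0` is required, so that `j₂` is covered, whose kernel is larger than `(p)`. An
element that is nilpotent modulo `p` cannot become a unit under `j`, so a unit under `j` is already
a unit modulo `p`. -/
theorem primeTo_iff_exists_isUnit {k : ℕ} [IsCyclotomicExtension {p ^ k} ℚ K] {ζ : K}
    (h : IsPrimitiveRoot ζ (p ^ k)) {F : Type*} [CommRing F] [Nontrivial F] {j : 𝓞 K →+* F}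
    (hj : j p = 0) {I : Ideal (𝓞 K)} : PrimeTo p I ↔ ∃ a ∈ I, IsUnit (j a) := by
  rw [PrimeTo, pIdeal, Ideal.isCoprime_iff_exists]
  constructor
  · rintro ⟨a, ha, b, hb, hab⟩
    obtain ⟨c, rfl⟩ := Ideal.mem_span_singleton'.1 hb
    refine ⟨a, ha, ?_⟩
    have := congrArg j hab
    rw [map_add, map_mul, hj, mul_zero, add_zero, map_one] at this
    rw [this]
    exact isUnit_one
  · rintro ⟨a, ha, hu⟩
    rcases isUnit_or_isNilpotent_quotient h (Ideal.Quotient.mk _ a) with hq | ⟨n, hn⟩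
    · obtain ⟨c, hc⟩ := hq.exists_left_inv
      obtain ⟨y, rfl⟩ := Ideal.Quotient.mk_surjective c
      rw [← map_mul, ← map_one (Ideal.Quotient.mk _), Ideal.Quotient.eq] at hc
      exact ⟨y * a, I.mul_mem_left _ ha, 1 - y * a, by rw [← neg_sub]; exact neg_mem hc, by ring⟩
    · rw [← map_pow, Ideal.Quotient.eq_zero_iff_mem] at hn
      obtain ⟨c, hc⟩ := Ideal.mem_span_singleton'.1 hn
      have := hu.pow n
      rw [← map_pow, ← hc, map_mul, hj, mul_zero] at this
      exact absurd this not_isUnit_zero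

theorem primeTo_iff_invertibleAt {k : ℕ} [IsCyclotomicExtension {p ^ k} ℚ K] {ζ : K}
    (h : IsPrimitiveRoot ζ (p ^ k)) {F : Type*} [CommRing F] [Nontrivial F] {j : 𝓞 K →+* F}
    (hj : j p = 0) {I : Ideal (𝓞 K)} : PrimeTo p I ↔ I.InvertibleAt j := by
  rw [primeTo_iff_exists_isUnit h hj]
  refine ⟨?_, fun hI ↦ hI.exists_isUnit⟩
  rintro ⟨a, ha, hu⟩
  obtain ⟨I', hI'⟩ := Ideal.dvd_span_singleton.2 ha
  exact ⟨I', a, hI'.symm, hu⟩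

variable {ζ₁ : K} (h₁ : IsPrimitiveRoot ζ₁ p) {ζ₂ : L} (h₂ : IsPrimitiveRoot ζ₂ (p ^ 2))

section

variable [IsCyclotomicExtension {p ^ 2} ℚ L]

theorem j₂_natCast : j₂ h₁ h₂ p = 0 := by
  rw [map_natCast]
  exact natCast_quotient _ p

theorem j₂_aeval (P : ℤ[X]) :
    j₂ h₁ h₂ (aeval h₂.toInteger P) = j₁ p K (aeval h₁.toInteger P) := by
  rw [map_aeval_int, map_aeval_int, j₂_toInteger]

theorem j₂_surjective [IsCyclotomicExtension {p} ℚ K] : Function.Surjective (j₂ h₁ h₂) := by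
  intro c
  obtain ⟨x, rfl⟩ := Ideal.Quotient.mk_surjective c
  obtain ⟨P, rfl⟩ := exists_aeval_toInteger h₁ x
  exact ⟨aeval h₂.toInteger P, j₂_aeval h₁ h₂ P⟩

theorem finrank_cyclotomic_tower [IsCyclotomicExtension {p} ℚ K] [Algebra K L] :
    Module.finrank K L = p := by
  have hp := (Fact.out : p.Prime)
  have h := Module.finrank_mul_finrank ℚ K L
  rw [IsCyclotomicExtension.finrank (n := p) K (cyclotomic.irreducible_rat hp.pos),
    IsCyclotomicExtension.finrank (n := p ^ 2) L (cyclotomic.irreducible_rat (pow_pos hp.pos 2)),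
    Nat.totient_prime hp, Nat.totient_prime_pow hp two_pos, mul_comm] at h
  have : 0 < p - 1 := by have := hp.two_le; omega
  simpa using Nat.eq_of_mul_eq_mul_right this h

/-- The reduction of the norm modulo `p`. -/
theorem j₁_intNorm [IsCyclotomicExtension {p} ℚ K] [Algebra K L]
    (hζ : algebraMap K L ζ₁ = ζ₂ ^ p) (x : 𝓞 L) :
    j₁ p K (Algebra.intNorm (𝓞 K) (𝓞 L) x) = j₂ h₁ h₂ x := by
  obtain ⟨P, rfl⟩ := exists_aeval_toInteger h₂ x
  -- By degree, the powers of `ζ₂` below `p` then form a basis over `K`, in which multiplication by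
  -- `ζ₂` is the shift matrix.
  have hadj : Algebra.adjoin K {ζ₂} = ⊤ := by
    have hQ := IsCyclotomicExtension.adjoin_primitive_root_eq_top (A := ℚ) h₂
    rw [eq_top_iff]
    intro y _
    have hy : y ∈ Algebra.adjoin ℚ {ζ₂} := hQ ▸ Algebra.mem_top
    have hle : Algebra.adjoin ℚ {ζ₂} ≤ (Algebra.adjoin K {ζ₂}).restrictScalars ℚ :=
      Algebra.adjoin_le (Set.singleton_subset_iff.2
        ((Subalgebra.mem_restrictScalars ℚ).2 (Algebra.self_mem_adjoin_singleton K ζ₂)))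
    exact (Subalgebra.mem_restrictScalars ℚ).1 (hle hy)
  let pb := PowerBasis.ofAdjoinEqTop' (Algebra.IsIntegral.isIntegral (R := K) ζ₂) hadj
  have hdim : pb.dim = p := by rw [← pb.finrank, finrank_cyclotomic_tower (p := p)]
  let b := pb.basis.reindex (finCongr hdim)
  have hb (i : Fin p) : b i = ζ₂ ^ (i : ℕ) := by
    rw [Module.Basis.reindex_apply, pb.basis_eq_pow, PowerBasis.ofAdjoinEqTop'_gen]
    rfl
  have hn : Algebra.intNorm (𝓞 K) (𝓞 L) (aeval h₂.toInteger P) = shiftNorm p h₁.toInteger P := by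
    refine RingOfIntegers.coe_injective (K := K) ?_
    have e1 := Algebra.algebraMap_intNorm (A := 𝓞 K) (K := K) (L := L) (aeval h₂.toInteger P)
    have e2 := map_shiftNorm (p := p) (algebraMap (𝓞 K) K) h₁.toInteger P
    have e3 := map_aeval_int (algebraMap (𝓞 L) L) h₂.toInteger P
    have e4 := norm_aeval_eq_shiftNorm hζ.symm b hb P
    rw [e3] at e1
    exact e1.trans (e4.trans e2.symm)
  rw [hn, map_shiftNorm, shiftNorm_eq_aeval (natCast_quotient _ p), j₂_aeval, map_aeval_int,
    ← eval₂_intCast_eq_aeval, ← eval₂_intCast_eq_aeval]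

end

/-! ### Cyclotomic polynomials and the group ring -/

theorem aeval_cyclotomic_toInteger {n : ℕ} [NeZero n] {K : Type*} [Field K] [CharZero K] {ζ : K}
    (h : IsPrimitiveRoot ζ n) :
    aeval h.toInteger (cyclotomic n ℤ) = 0 := by
  have := h.toInteger_isPrimitiveRoot.isRoot_cyclotomic (NeZero.pos n)
  rwa [← map_cyclotomic_int n (𝓞 K), IsRoot.def, eval_map, eval₂_intCast_eq_aeval] at this

theorem aeval_cyclotomic_sq {p : ℕ} [Fact p.Prime] {K : Type*} [Field K] [CharZero K] {ζ₁ : K}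
    (h₁ : IsPrimitiveRoot ζ₁ p) : aeval h₁.toInteger (cyclotomic (p ^ 2) ℤ) = p := by
  have hone : h₁.toInteger ^ p = 1 := h₁.toInteger_isPrimitiveRoot.pow_eq_one
  rw [cyclotomic_prime_pow_eq_geom_sum (Fact.out : p.Prime)]
  simp [hone]

/-- The generator of the cyclic group in its group ring. -/
def gen (p : ℕ) : GroupRing p := MonoidAlgebra.of ℤ _ (Multiplicative.ofAdd 1)

/-- The augmentation of the group ring. -/
def aug (p : ℕ) : GroupRing p →+* ℤ :=
  (MonoidAlgebra.lift ℤ ℤ (Multiplicative (ZMod (p ^ 2))) 1).toRingHom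

theorem aug_gen (p : ℕ) : aug p (gen p) = 1 := by
  simp [aug, gen]

theorem gen_pow (p : ℕ) : gen p ^ p ^ 2 = 1 := by
  rw [gen, ← map_pow, ← ofAdd_nsmul, nsmul_one, ZMod.natCast_self, ofAdd_zero, map_one]

theorem aug_eval₂_gen (p : ℕ) (P : ℤ[X]) :
    aug p (P.eval₂ (Int.castRingHom _) (gen p)) = P.eval 1 := by
  rw [map_eval₂_intCast, aug_gen, eval₂_intCast_eq_aeval, coe_aeval_eq_eval]

theorem exists_eval₂_gen {p : ℕ} [NeZero p] (x : GroupRing p) :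
    ∃ P : ℤ[X], P.eval₂ (Int.castRingHom _) (gen p) = x := by
  induction x using MonoidAlgebra.induction_on with
  | of m =>
    refine ⟨X ^ (Multiplicative.toAdd m).val, ?_⟩
    rw [eval₂_X_pow, gen, ← map_pow, ← ofAdd_nsmul, nsmul_one, ZMod.natCast_zmod_val, ofAdd_toAdd]
  | add x y hx hy =>
    obtain ⟨P, rfl⟩ := hx
    obtain ⟨Q, rfl⟩ := hy
    exact ⟨P + Q, eval₂_add _ _⟩
  | smul n x hx =>
    obtain ⟨P, rfl⟩ := hx
    exact ⟨C n * P, by rw [eval₂_mul, eval₂_C, zsmul_eq_mul, eq_intCast]⟩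

/-! ### The Milnor square of `A` -/

variable {p : ℕ} [Fact p.Prime] {K : Type*} [Field K] [NumberField K]
  {L : Type*} [Field L] [NumberField L] [IsCyclotomicExtension {p ^ 2} ℚ L]
  {ζ₁ : K} (h₁ : IsPrimitiveRoot ζ₁ p) {ζ₂ : L} (h₂ : IsPrimitiveRoot ζ₂ (p ^ 2))

/-- The Milnor square that defines `A`. -/
def squareA [IsCyclotomicExtension {p} ℚ K] :
    MilnorSquare (A h₁ h₂) (𝓞 K × 𝓞 L) (𝓞 K) (𝓞 L) (F p K) where
  p₁ := RingHom.fst _ _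
  p₂ := RingHom.snd _ _
  j₁ := j₁ p K
  j₂ := j₂ h₁ h₂
  exists_pair x y := ⟨(x, y), rfl, rfl⟩
  ext h h' := Prod.ext h h'
  surjective₁ := j₁_surjective p K
  surjective₂ := j₂_surjective h₁ h₂
  injective := Subtype.val_injective
  comm r := r.2
  lift t ht := ⟨⟨t, ht⟩, rfl⟩
  regular₁ s hs := mem_nonZeroDivisors_of_ne_zero (by
    rintro rfl
    rw [map_zero] at hs
    exact not_isUnit_zero hs)
  regular₂ s hs := mem_nonZeroDivisors_of_ne_zero (by
    rintro rfl
    rw [map_zero] at hs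
    exact not_isUnit_zero hs)

/-! ### The comparison of the group ring with `A` -/

theorem mem_nonZeroDivisors_A {a : A h₁ h₂} (ha₁ : a.1.1 ≠ 0) (ha₂ : a.1.2 ≠ 0) :
    a ∈ (A h₁ h₂)⁰ := by
  rw [mem_nonZeroDivisors_iff_right]
  intro x hx
  have e₁ : x.1.1 * a.1.1 = 0 := congrArg (fun y : A h₁ h₂ ↦ y.1.1) hx
  have e₂ : x.1.2 * a.1.2 = 0 := congrArg (fun y : A h₁ h₂ ↦ y.1.2) hx
  exact Subtype.ext (Prod.ext ((mul_eq_zero_iff_right ha₁).1 e₁) ((mul_eq_zero_iff_right ha₂).1 e₂))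

theorem groupRingToA_gen : groupRingToA h₁ h₂ (gen p) = zetaPair h₁ h₂ := by
  have : (1 : ZMod (p ^ 2)).val = 1 :=
    ZMod.val_one'' (Nat.one_lt_pow two_ne_zero (Fact.out : p.Prime).one_lt).ne'
  simp [groupRingToA, gen, cyclicHom, this]

theorem groupRingToA_eval₂_gen_fst (P : ℤ[X]) :
    (groupRingToA h₁ h₂ (P.eval₂ (Int.castRingHom _) (gen p))).1.1 = aeval h₁.toInteger P := by
  rw [map_eval₂_intCast, groupRingToA_gen, ← eval₂_intCast_eq_aeval]
  exact map_eval₂_intCast ((RingHom.fst (𝓞 K) (𝓞 L)).comp (A h₁ h₂).subtype) _ P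

theorem groupRingToA_eval₂_gen_snd (P : ℤ[X]) :
    (groupRingToA h₁ h₂ (P.eval₂ (Int.castRingHom _) (gen p))).1.2 = aeval h₂.toInteger P := by
  rw [map_eval₂_intCast, groupRingToA_gen, ← eval₂_intCast_eq_aeval]
  exact map_eval₂_intCast ((RingHom.snd (𝓞 K) (𝓞 L)).comp (A h₁ h₂).subtype) _ P

theorem cyclotomic_dvd_of_aeval_toInteger {n : ℕ} [NeZero n] {ζ : K} (h : IsPrimitiveRoot ζ n)
    {P : ℤ[X]} (hP : aeval h.toInteger P = 0) : cyclotomic n ℤ ∣ P := by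
  rw [cyclotomic_eq_minpoly h (NeZero.pos n)]
  refine minpoly.isIntegrallyClosed_dvd (h.isIntegral (NeZero.pos n)) ?_
  have := congrArg (algebraMap (𝓞 K) K) hP
  rw [map_aeval_int, map_zero] at this
  exact this

/-- A polynomial matching the second coordinate misses the first by a multiple of `p`. Multiples of
`Φ_{p²}` correct this, as `Φ_{p²}` is `p` at `ζ₁` and `0` at `ζ₂`. -/
theorem groupRingToA_surjective [IsCyclotomicExtension {p} ℚ K] :
    Function.Surjective (groupRingToA h₁ h₂) := by
  rintro ⟨⟨x, y⟩, hxy⟩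
  obtain ⟨P, rfl⟩ := exists_aeval_toInteger h₂ y
  have hxy : j₁ p K x = j₂ h₁ h₂ (aeval h₂.toInteger P) := hxy
  rw [j₂_aeval, Ideal.Quotient.eq] at hxy
  obtain ⟨z, hz⟩ := Ideal.mem_span_singleton'.1 hxy
  obtain ⟨Q, rfl⟩ := exists_aeval_toInteger h₁ z
  refine ⟨(P + Q * cyclotomic (p ^ 2) ℤ).eval₂ (Int.castRingHom _) (gen p),
    Subtype.ext (Prod.ext ?_ ?_)⟩
  · rw [groupRingToA_eval₂_gen_fst, map_add, map_mul, aeval_cyclotomic_sq, hz, add_sub_cancel]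
  · rw [groupRingToA_eval₂_gen_snd, map_add, map_mul, aeval_cyclotomic_toInteger h₂, mul_zero,
      add_zero]

theorem dvd_of_groupRingToA_eq_zero {P : ℤ[X]}
    (hP : groupRingToA h₁ h₂ (P.eval₂ (Int.castRingHom _) (gen p)) = 0) :
    cyclotomic p ℤ * cyclotomic (p ^ 2) ℤ ∣ P := by
  have e₁ := groupRingToA_eval₂_gen_fst h₁ h₂ P
  have e₂ := groupRingToA_eval₂_gen_snd h₁ h₂ P
  rw [hP] at e₁ e₂
  obtain ⟨Q, rfl⟩ := cyclotomic_dvd_of_aeval_toInteger h₁ e₁.symm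
  refine mul_dvd_mul_left _ (cyclotomic_dvd_of_aeval_toInteger h₂ ?_)
  have e₃ : aeval h₂.toInteger (cyclotomic p ℤ * Q) = 0 := e₂.symm
  rw [map_mul, mul_eq_zero] at e₃
  -- If `Φ_p(ζ₂)` were zero, `Φ_{p²}` would divide `Φ_p`, but its degree `p(p - 1)` is too large.
  refine e₃.resolve_left fun h0 ↦ ?_
  have hd := natDegree_le_of_dvd (cyclotomic_dvd_of_aeval_toInteger h₂ h0) (cyclotomic_ne_zero p ℤ)
  have hp := (Fact.out : p.Prime)
  rw [natDegree_cyclotomic, natDegree_cyclotomic, Nat.totient_prime hp,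
    Nat.totient_prime_pow hp two_pos] at hd
  have h2 := hp.two_le
  have : p ^ (2 - 1) * (p - 1) ≤ 1 * (p - 1) := by simpa using hd
  have := Nat.le_of_mul_le_mul_right this (by omega)
  simp at this
  omega

theorem eval_one_cyclotomic_mul :
    (cyclotomic p ℤ * cyclotomic (p ^ 2) ℤ).eval 1 = ((p ^ 2 : ℕ) : ℤ) := by
  have h2 : eval 1 (cyclotomic (p ^ 2) ℤ) = (p : ℤ) := eval_one_cyclotomic_prime_pow 1
  rw [eval_mul, eval_one_cyclotomic_prime, h2]
  push_cast
  ring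

theorem cyclotomic_mul_mul_X_sub_one :
    cyclotomic p ℤ * cyclotomic (p ^ 2) ℤ * (X - 1) = X ^ p ^ 2 - 1 := by
  have e := cyclotomic_prime_pow_mul_X_pow_sub_one ℤ p 1
  rw [pow_one, ← cyclotomic_prime_mul_X_sub_one ℤ p] at e
  rw [← e]
  ring

/-- A polynomial `Φ_p Φ_{p²} Q` has augmentation `p² Q(1)`. If this vanishes, `X - 1` divides `Q`
and the polynomial is a multiple of `X ^ p² - 1`. -/
theorem groupRing_eq_zero {x : GroupRing p} (hx : aug p x = 0) (hx' : groupRingToA h₁ h₂ x = 0) :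
    x = 0 := by
  obtain ⟨P, rfl⟩ := exists_eval₂_gen x
  obtain ⟨Q, rfl⟩ := dvd_of_groupRingToA_eq_zero h₁ h₂ hx'
  rw [aug_eval₂_gen, eval_mul, eval_one_cyclotomic_mul, mul_eq_zero] at hx
  have hQ : IsRoot Q 1 := hx.resolve_left
    (Nat.cast_ne_zero.2 (pow_ne_zero 2 (Fact.out : p.Prime).ne_zero))
  obtain ⟨S, rfl⟩ := dvd_iff_isRoot.2 hQ
  rw [C_1, ← mul_assoc, cyclotomic_mul_mul_X_sub_one, eval₂_mul, eval₂_sub, eval₂_X_pow, eval₂_one,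
    gen_pow, sub_self, zero_mul]

/-! ### The fibre square of `ℤ` and `A` over `ℤ/p²` -/

variable [IsCyclotomicExtension {p} ℚ K]

/-- The homomorphism `A → ℤ / p ^ 2` that sends `(ζ₁, ζ₂)` to `1`. -/
def augA : A h₁ h₂ →+* ZMod (p ^ 2) :=
  (groupRingToA h₁ h₂).liftOfSurjective (groupRingToA_surjective h₁ h₂)
    ⟨(Int.castRingHom (ZMod (p ^ 2))).comp (aug p), fun x hx ↦ by
      obtain ⟨P, rfl⟩ := exists_eval₂_gen x
      obtain ⟨Q, rfl⟩ := dvd_of_groupRingToA_eq_zero h₁ h₂ hx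
      rw [RingHom.mem_ker, RingHom.comp_apply, aug_eval₂_gen, eval_mul, eval_one_cyclotomic_mul,
        map_mul, map_natCast, ZMod.natCast_self, zero_mul]⟩

theorem augA_groupRingToA (x : GroupRing p) : augA h₁ h₂ (groupRingToA h₁ h₂ x) = aug p x :=
  RingHom.liftOfSurjective_comp_apply _ _ _ _

/-- If a coordinate vanishes, `Φ_p` or `Φ_{p²}` divides the polynomial. Both take the value `p` at
`1`, so the augmentation is not a unit. -/
theorem mem_nonZeroDivisors_of_isUnit_augA {a : A h₁ h₂} (ha : IsUnit (augA h₁ h₂ a)) :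
    a ∈ (A h₁ h₂)⁰ := by
  obtain ⟨x, rfl⟩ := groupRingToA_surjective h₁ h₂ a
  obtain ⟨P, rfl⟩ := exists_eval₂_gen x
  rw [augA_groupRingToA, aug_eval₂_gen] at ha
  have hnd : ¬ (p : ℤ) ∣ P.eval 1 := by
    intro hd
    have h0 := ha.map (ZMod.castHom (dvd_pow_self p two_ne_zero) (ZMod p))
    rw [map_intCast, (ZMod.intCast_zmod_eq_zero_iff_dvd _ p).2 hd] at h0
    exact not_isUnit_zero h0
  refine mem_nonZeroDivisors_A h₁ h₂ (fun h0 ↦ hnd ?_) (fun h0 ↦ hnd ?_)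
  · rw [groupRingToA_eval₂_gen_fst] at h0
    have := eval_dvd (x := 1) (cyclotomic_dvd_of_aeval_toInteger h₁ h0)
    rwa [eval_one_cyclotomic_prime] at this
  · rw [groupRingToA_eval₂_gen_snd] at h0
    have := eval_dvd (x := 1) (cyclotomic_dvd_of_aeval_toInteger h₂ h0)
    rwa [show eval 1 (cyclotomic (p ^ 2) ℤ) = (p : ℤ) from eval_one_cyclotomic_prime_pow 1] at this

/-- After multiplication by `a - 1` the product telescopes to `a ^ (r * s) - 1 = a - 1`. -/
theorem geom_sum_mul_geom_sum_pow_eq_one {R : Type*} [CommRing R] {a : R} {n r s : ℕ}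
    (ha : a ^ n = 1) (hreg : a - 1 ∈ R⁰) (hrs : r * s ≡ 1 [MOD n]) :
    (∑ i ∈ Finset.range r, a ^ i) * ∑ i ∈ Finset.range s, (a ^ r) ^ i = 1 := by
  have h := pow_eq_pow_of_modEq hrs ha
  refine (mul_cancel_left_mem_nonZeroDivisors hreg).1 ?_
  rw [← mul_assoc, mul_geom_sum, mul_geom_sum, ← pow_mul, h, mul_one, pow_one]

/-- The cyclotomic units of `A` lift all units of `ℤ / p ^ 2`. -/
theorem exists_unit_augA_eq (h : (ZMod (p ^ 2))ˣ) : ∃ u : (A h₁ h₂)ˣ, augA h₁ h₂ u = h := by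
  have hp := (Fact.out : p.Prime)
  have ha : augA h₁ h₂ (zetaPair h₁ h₂) = 1 := by
    rw [← groupRingToA_gen h₁ h₂, augA_groupRingToA, aug_gen, Int.cast_one]
  have hreg : zetaPair h₁ h₂ - 1 ∈ (A h₁ h₂)⁰ := by
    refine mem_nonZeroDivisors_A h₁ h₂ ?_ ?_
    · exact sub_ne_zero.2 (h₁.toInteger_isPrimitiveRoot.ne_one hp.one_lt)
    · exact sub_ne_zero.2
        (h₂.toInteger_isPrimitiveRoot.ne_one (Nat.one_lt_pow two_ne_zero hp.one_lt))
  have hmod : (h : ZMod (p ^ 2)).val * ((h⁻¹ : (ZMod (p ^ 2))ˣ) : ZMod (p ^ 2)).val ≡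
      1 [MOD p ^ 2] := by
    rw [← ZMod.natCast_eq_natCast_iff, Nat.cast_mul, ZMod.natCast_zmod_val, ZMod.natCast_zmod_val,
      Units.mul_inv, Nat.cast_one]
  -- The unit is `1 + a + ⋯ + a ^ (r - 1)` with `a = (ζ₁, ζ₂)` and `r` the least residue of `h`;
  -- since `a` maps to `1`, its image counts the `r` terms.
  refine ⟨Units.mkOfMulEqOne _ _
    (geom_sum_mul_geom_sum_pow_eq_one (zetaPair_pow h₁ h₂) hreg hmod), ?_⟩
  rw [Units.val_mkOfMulEqOne, map_sum]
  simp only [map_pow, ha, one_pow, Finset.sum_const, Finset.card_range, nsmul_eq_mul, mul_one]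
  exact ZMod.natCast_zmod_val _

theorem isLocalRing_zmod_sq : IsLocalRing (ZMod (p ^ 2)) := by
  have hp := (Fact.out : p.Prime)
  have : Fact (1 < p ^ 2) := ⟨Nat.one_lt_pow two_ne_zero hp.one_lt⟩
  refine isLocalRing_of_isUnit_or_isNilpotent fun x ↦ ?_
  rw [← ZMod.natCast_zmod_val x]
  by_cases hd : p ∣ x.val
  · refine .inr ⟨2, ?_⟩
    rw [← Nat.cast_pow, ZMod.natCast_eq_zero_iff]
    exact pow_dvd_pow_of_dvd hd 2
  · exact .inl ((ZMod.isUnit_iff_coprime _ _).2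
      (((hp.coprime_iff_not_dvd).2 hd).symm.pow_right 2))

theorem mapRingHom_groupRingToA_bijective :
    Function.Bijective (Pic.mapRingHom (groupRingToA h₁ h₂)) := by
  let : Algebra (GroupRing p) (ℤ × A h₁ h₂) := ((aug p).prod (groupRingToA h₁ h₂)).toAlgebra
  let S : MilnorSquare (GroupRing p) (ℤ × A h₁ h₂) ℤ (A h₁ h₂) (ZMod (p ^ 2)) :=
    { p₁ := RingHom.fst _ _
      p₂ := RingHom.snd _ _
      j₁ := Int.castRingHom _
      j₂ := augA h₁ h₂
      exists_pair := fun x y ↦ ⟨(x, y), rfl, rfl⟩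
      ext := fun h h' ↦ Prod.ext h h'
      surjective₁ := ZMod.intCast_surjective
      surjective₂ := fun x ↦ by
        obtain ⟨n, rfl⟩ := ZMod.intCast_surjective x
        exact ⟨n, map_intCast _ n⟩
      injective := (injective_iff_map_eq_zero _).2 fun x hx ↦
        groupRing_eq_zero h₁ h₂ (congrArg Prod.fst hx) (congrArg Prod.snd hx)
      comm := fun r ↦ (augA_groupRingToA h₁ h₂ r).symm
      lift := by
        rintro ⟨n, a⟩ h
        obtain ⟨x, rfl⟩ := groupRingToA_surjective h₁ h₂ a
        have h : ((n : ℤ) : ZMod (p ^ 2)) = augA h₁ h₂ (groupRingToA h₁ h₂ x) := h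
        rw [augA_groupRingToA, eq_comm, ZMod.intCast_eq_intCast_iff_dvd_sub] at h
        obtain ⟨k, hk⟩ := h
        -- This element has augmentation `k * p²` and vanishes in `A`.
        let N := (C k * (cyclotomic p ℤ * cyclotomic (p ^ 2) ℤ)).eval₂ (Int.castRingHom _) (gen p)
        refine ⟨x + N, Prod.ext ?_ ?_⟩
        · change aug p (x + N) = n
          rw [map_add, aug_eval₂_gen, eval_mul, eval_one_cyclotomic_mul, eval_C, mul_comm k, ← hk,
            add_sub_cancel]
        · change groupRingToA h₁ h₂ (x + N) = _
          have hN : groupRingToA h₁ h₂ N = 0 := by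
            refine Subtype.ext (Prod.ext ?_ ?_)
            · rw [groupRingToA_eval₂_gen_fst, map_mul, map_mul, aeval_cyclotomic_toInteger h₁,
                zero_mul, mul_zero]
              rfl
            · rw [groupRingToA_eval₂_gen_snd, map_mul, map_mul, aeval_cyclotomic_toInteger h₂,
                mul_zero, mul_zero]
              rfl
          rw [map_add, hN, add_zero]
      regular₁ := fun s hs ↦ mem_nonZeroDivisors_of_ne_zero (by
        have := (isLocalRing_zmod_sq (p := p)).toNontrivial
        rintro rfl
        rw [map_zero] at hs
        exact not_isUnit_zero hs)
      regular₂ := fun _ hs ↦ mem_nonZeroDivisors_of_isUnit_augA h₁ h₂ hs }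
  have := isLocalRing_zmod_sq (p := p)
  exact S.mapRingHom_bijective (exists_unit_augA_eq h₁ h₂)

end CyclicPic

/-! ### Group theory -/

/-- A group homomorphism given on representatives. -/
theorem exists_monoidHom_of_surjective {T G G' : Type*} [Group G] [Group G'] {u : T → G}
    {v : T → G'} (hu : Function.Surjective u)
    (hmul : ∀ s t, ∃ r, u r = u s * u t ∧ v r = v s * v t) (hone : ∀ t, u t = 1 → v t = 1) :
    ∃ f : G →* G', ∀ t, f (u t) = v t := by
  -- Representatives carry no inverses, so `s` and `t` are compared after multiplying both by a
  -- representative `w` of the inverse class.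
  have hwd {s t : T} (h : u s = u t) : v s = v t := by
    obtain ⟨w, hw⟩ := hu (u s)⁻¹
    obtain ⟨r, hr, hr'⟩ := hmul s w
    obtain ⟨r', hs, hs'⟩ := hmul t w
    have e := hone r (by rw [hr, hw, mul_inv_cancel])
    have e' := hone r' (by rw [hs, hw, h, mul_inv_cancel])
    rw [hr'] at e
    rw [hs'] at e'
    exact mul_right_cancel (e.trans e'.symm)
  refine ⟨MonoidHom.mk' (fun g ↦ v (Function.surjInv hu g)) fun a b ↦ ?_,
    fun t ↦ hwd (Function.surjInv_eq hu _)⟩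
  obtain ⟨r, hr, hr'⟩ := hmul (Function.surjInv hu a) (Function.surjInv hu b)
  rw [← hr']
  refine hwd ?_
  rw [hr, Function.surjInv_eq hu, Function.surjInv_eq hu, Function.surjInv_eq hu]

theorem inv_mul_mul_mul_comm {G : Type*} [CommGroup G] (a b c d : G) :
    (a * b)⁻¹ * (c * d) = a⁻¹ * c * (b⁻¹ * d) := by
  rw [mul_inv, mul_mul_mul_comm]

theorem Subgroup.normal_of_forall_mul_comm {G : Type*} [Group G] (h : ∀ x y : G, x * y = y * x)
    (N : Subgroup G) : N.Normal :=
  ⟨fun n hn g ↦ by rwa [h g, mul_inv_cancel_right]⟩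

/-- All subgroups are normal, so the join of two `p`-subgroups is a `p`-subgroup and a Sylow
subgroup contains every `p`-subgroup. No finiteness is involved. -/
theorem Sylow.exists_mulEquiv_of_mulEquiv {G G' : Type*} [Group G] [Group G'] {p : ℕ}
    (Θ : G ≃* G') (P : Sylow p G) (Q : Sylow p G') (h : ∀ x y : G, x * y = y * x) :
    ∃ e : P ≃* Q, ∀ x : P, (e x : G') = Θ x := by
  have := Subgroup.normal_of_forall_mul_comm h P.toSubgroup
  have := Subgroup.normal_of_forall_mul_comm (fun x y ↦ Θ.symm.injective <| by
    rw [map_mul, map_mul, h]) Q.toSubgroup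
  have hle₁ : P.toSubgroup.map Θ.toMonoidHom ≤ Q :=
    le_sup_left.trans (Q.is_maximal' ((P.isPGroup'.map Θ.toMonoidHom).to_sup_of_normal_right
      Q.isPGroup') le_sup_right).le
  have hle₂ : Q.toSubgroup.map Θ.symm.toMonoidHom ≤ P :=
    le_sup_left.trans (P.is_maximal' ((Q.isPGroup'.map Θ.symm.toMonoidHom).to_sup_of_normal_right
      P.isPGroup') le_sup_right).le
  have heq : P.toSubgroup.map Θ.toMonoidHom = Q :=
    le_antisymm hle₁ fun x hx ↦ ⟨Θ.symm x, hle₂ ⟨x, hx, rfl⟩, Θ.apply_symm_apply x⟩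
  exact ⟨(Θ.subgroupMap P.toSubgroup).trans (MulEquiv.subgroupCongr heq), fun _ ↦ rfl⟩

/-- The image of a homomorphism that is a section up to an isomorphism is a complement of the
kernel. -/
theorem MonoidHom.isCompl_range_ker {G H C : Type*} [CommGroup G] [CommGroup H] [CommGroup C]
    {f : C →* G} {g : G →* H} (e : C ≃* H) (h : g.comp f = e.toMonoidHom) :
    IsCompl f.range g.ker := by
  have h' (c : C) : g (f c) = e c := DFunLike.congr_fun h c
  rw [isCompl_iff, disjoint_iff, codisjoint_iff, eq_bot_iff, eq_top_iff]
  constructor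
  · rintro _ ⟨⟨c, rfl⟩, hc⟩
    have hc : g (f c) = 1 := hc
    rw [h', EmbeddingLike.map_eq_one_iff] at hc
    rw [hc, map_one]
    exact one_mem _
  · intro x _
    refine Subgroup.mem_sup.2 ⟨f (e.symm (g x)), ⟨_, rfl⟩, (f (e.symm (g x)))⁻¹ * x, ?_,
      mul_inv_cancel_left _ _⟩
    rw [MonoidHom.mem_ker, map_mul, map_inv, h', e.apply_symm_apply, inv_mul_cancel]

/-! ### Class groups -/

theorem ClassGroup.equivPic_mk0 {R : Type*} [CommRing R] [IsDedekindDomain R] (I : (Ideal R)⁰)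
    [Module.Invertible R I.1] : ClassGroup.equivPic R (ClassGroup.mk0 I) = Pic.mk R I.1 := by
  rw [ClassGroup.mk0_eq_quotientMk, eq_comm, Pic.mk_eq_iff]
  let U := FractionalIdeal.unitsMulEquivSubmodule (FractionalIdeal.mk0 (FractionRing R) I)
  have e : Submodule.unitsToPic R (FractionRing R) U ≃ₗ[R] U := Submodule.unitsToPicEquiv U
  exact ⟨(Submodule.equivMapOfInjective (Algebra.linearMap R (FractionRing R))
    (IsFractionRing.injective R (FractionRing R)) I.1).trans e.symm⟩

namespace CyclicPic

variable {p : ℕ} [Fact p.Prime] {K : Type*} [Field K] [NumberField K]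

/-! ### The ray class group -/

theorem PrimeTo.rayClass_congr {I J : Ideal (𝓞 K)} (hI : PrimeTo p I) (hJ : PrimeTo p J)
    (h : I = J) : hI.rayClass = hJ.rayClass := by
  subst h
  rfl

theorem PrimeTo.unit_mul {I J : Ideal (𝓞 K)} (hI : PrimeTo p I) (hJ : PrimeTo p J)
    (hIJ : PrimeTo p (I * J)) : hIJ.unit = hI.unit * hJ.unit :=
  Units.ext (by simp [PrimeTo.unit])

theorem PrimeTo.rayClass_mul {I J : Ideal (𝓞 K)} (hI : PrimeTo p I) (hJ : PrimeTo p J)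
    (hIJ : PrimeTo p (I * J)) : hIJ.rayClass = hI.rayClass * hJ.rayClass := by
  rw [PrimeTo.rayClass, PrimeTo.rayClass, PrimeTo.rayClass, ← QuotientGroup.mk_mul]
  exact congrArg _ (Subtype.ext (hI.unit_mul hJ hIJ))

/-- If `I = (x * g)` with `g ≡ 1`, then `a = x * g` is integral and reduces to `h` like `x`.
Conversely, `g = a / x`. -/
theorem rayClass_inv_mul_eq_one_iff {x : 𝓞 K} {h : (F p K)ˣ} (hx : j₁ p K x = h)
    {I : Ideal (𝓞 K)} (hI : PrimeTo p I) :
    (primeTo_span hx).rayClass⁻¹ * hI.rayClass = 1 ↔ ∃ a, I = Ideal.span {a} ∧ j₁ p K a = h := by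
  have hne {y : 𝓞 K} (hy : j₁ p K y = h) : (y : K) ≠ 0 := by
    rw [RingOfIntegers.coe_ne_zero_iff]
    rintro rfl
    rw [map_zero] at hy
    exact h.ne_zero hy.symm
  rw [inv_mul_eq_one, PrimeTo.rayClass, PrimeTo.rayClass, QuotientGroup.eq,
    Subgroup.mem_subgroupOf]
  change (primeTo_span hx).unit⁻¹ * hI.unit ∈ H p K ↔ _
  constructor
  · rintro ⟨g, ⟨u, v, hv, huv, hg⟩, hgI⟩
    rw [eq_inv_mul_iff_mul_eq] at hgI
    have hgI : FractionalIdeal.spanSingleton (𝓞 K)⁰ ((x : K) * g) = I := by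
      have := congrArg Units.val hgI
      rw [Units.val_mul, coe_toPrincipalIdeal] at this
      rw [← FractionalIdeal.spanSingleton_mul_spanSingleton, ← FractionalIdeal.coeIdeal_span_singleton]
      exact this
    have hmem : (x : K) * g ∈ (I : FractionalIdeal (𝓞 K)⁰ K) := by
      rw [← hgI]
      exact FractionalIdeal.mem_spanSingleton_self _ _
    obtain ⟨a, -, ha⟩ := (FractionalIdeal.mem_coeIdeal _).1 hmem
    refine ⟨a, ?_, ?_⟩
    · rw [← ha, ← FractionalIdeal.coeIdeal_span_singleton] at hgI
      exact (FractionalIdeal.coeIdeal_injective hgI).symm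
    · have hau : a * v = x * u := by
        apply RingOfIntegers.coe_injective
        rw [map_mul, map_mul, ← hg, ha]
        ring
      have := congrArg (j₁ p K) hau
      rw [map_mul, map_mul, huv] at this
      rw [hv.mul_left_injective this, hx]
  · rintro ⟨a, rfl, ha⟩
    refine ⟨Units.mk0 ((a : K) / x) (div_ne_zero (hne ha) (hne hx)),
      ⟨a, x, hx ▸ h.isUnit, ha.trans hx.symm, ?_⟩, ?_⟩
    · rw [Units.val_mk0]
      exact div_mul_cancel₀ _ (hne hx)
    · rw [eq_inv_mul_iff_mul_eq]
      refine Units.ext ?_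
      rw [Units.val_mul, coe_toPrincipalIdeal, Units.val_mk0]
      change ((Ideal.span {x} : Ideal (𝓞 K)) : FractionalIdeal (𝓞 K)⁰ K) * _ =
        ((Ideal.span {a} : Ideal (𝓞 K)) : FractionalIdeal (𝓞 K)⁰ K)
      rw [FractionalIdeal.coeIdeal_span_singleton, FractionalIdeal.coeIdeal_span_singleton,
        FractionalIdeal.spanSingleton_mul_spanSingleton, mul_div_cancel₀]
      exact hne hx

variable {L : Type*} [Field L] [NumberField L] [IsCyclotomicExtension {p ^ 2} ℚ L]
  {ζ₁ : K} (h₁ : IsPrimitiveRoot ζ₁ p) {ζ₂ : L} (h₂ : IsPrimitiveRoot ζ₂ (p ^ 2))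

theorem primeTo_iff_invertibleAt_two {I : Ideal (𝓞 L)} :
    PrimeTo p I ↔ I.InvertibleAt (j₂ h₁ h₂) :=
  primeTo_iff_invertibleAt h₂ (j₂_natCast h₁ h₂)

theorem ne_zero_of_invertibleAt {β : Ideal (𝓞 L)} (hβ : β.InvertibleAt (j₂ h₁ h₂)) :
    β ∈ (Ideal (𝓞 L))⁰ := by
  rw [mem_nonZeroDivisors_iff_ne_zero]
  rintro rfl
  obtain ⟨a, ha, hu⟩ := hβ.exists_isUnit
  rw [(Submodule.mem_bot _).1 ha, map_zero] at hu
  exact not_isUnit_zero hu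

variable [IsCyclotomicExtension {p} ℚ K]

theorem primeTo_iff_invertibleAt_one {I : Ideal (𝓞 K)} :
    PrimeTo p I ↔ I.InvertibleAt (j₁ p K) := by
  have : IsCyclotomicExtension {p ^ 1} ℚ K := by rwa [pow_one]
  exact primeTo_iff_invertibleAt (k := 1) (IsCyclotomicExtension.zeta_spec (p ^ 1) ℚ K)
    (j₁_natCast p K)

/-- Choosing `b'` with `b * b' = (y)` clears the denominator: `a / b = y⁻¹ (a * b')`. -/
theorem exists_rayClass_eq (c : RayClassGroup p K) : ∃ (x : 𝓞 K) (h : (F p K)ˣ)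
    (hx : j₁ p K x = h) (I : Ideal (𝓞 K)) (hI : PrimeTo p I),
    (primeTo_span hx).rayClass⁻¹ * hI.rayClass = c := by
  obtain ⟨⟨J, a, b, ha, hb, rfl⟩, rfl⟩ := QuotientGroup.mk_surjective c
  obtain ⟨b', y, hy, hu⟩ := primeTo_iff_invertibleAt_one.1 hb
  have hb' : PrimeTo p b' :=
    primeTo_iff_invertibleAt_one.2 ⟨b, y, by rw [mul_comm, hy], hu⟩
  have hbb' : PrimeTo p (b * b') := IsCoprime.mul_left hb hb'
  have hab' : PrimeTo p (a * b') := IsCoprime.mul_left ha hb'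
  refine ⟨y, hu.unit, hu.unit_spec.symm, a * b', hab', ?_⟩
  rw [(primeTo_span hu.unit_spec.symm).rayClass_congr hbb' hy.symm, hb.rayClass_mul hb',
    ha.rayClass_mul hb']
  exact (inv_mul_eq_div _ _).trans (mul_div_mul_right_eq_div ha.rayClass hb.rayClass hb'.rayClass)

/-! ### Classes of glued modules -/

section

variable {α γ : Ideal (𝓞 K)} {β δ : Ideal (𝓞 L)}

/-- The class of `M(α, β, h)` in the Picard group of `A`. -/
def picM (hα : α.InvertibleAt (j₁ p K)) (hβ : β.InvertibleAt (j₂ h₁ h₂)) (h : (F p K)ˣ) :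
    Pic (A h₁ h₂) :=
  (squareA h₁ h₂).picGlue hα hβ h

theorem picM_eq_iff {hα : α.InvertibleAt (j₁ p K)} {hβ : β.InvertibleAt (j₂ h₁ h₂)}
    {h : (F p K)ˣ} {X : Pic (A h₁ h₂)} :
    picM h₁ h₂ hα hβ h = X ↔ IsClassOf h₁ h₂ X (M h₁ h₂ α β h) :=
  (squareA h₁ h₂).picGlue_eq_iff

theorem picM_congr {hα : α.InvertibleAt (j₁ p K)} {hβ : β.InvertibleAt (j₂ h₁ h₂)}
    {hγ : γ.InvertibleAt (j₁ p K)} {hδ : δ.InvertibleAt (j₂ h₁ h₂)} {h k : (F p K)ˣ}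
    (e₁ : α = γ) (e₂ : β = δ) (e : h = k) : picM h₁ h₂ hα hβ h = picM h₁ h₂ hγ hδ k := by
  subst e₁ e₂ e
  rfl

theorem picM_mul (hα : α.InvertibleAt (j₁ p K)) (hβ : β.InvertibleAt (j₂ h₁ h₂))
    (hγ : γ.InvertibleAt (j₁ p K)) (hδ : δ.InvertibleAt (j₂ h₁ h₂)) (h k : (F p K)ˣ) :
    picM h₁ h₂ hα hβ h * picM h₁ h₂ hγ hδ k =
      picM h₁ h₂ (hα.mul hγ) (hβ.mul hδ) (h * k) :=
  (squareA h₁ h₂).picGlue_mul hα hβ hγ hδ h k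

theorem picM_eq_one_iff (hα : α.InvertibleAt (j₁ p K)) (hβ : β.InvertibleAt (j₂ h₁ h₂))
    (h : (F p K)ˣ) : picM h₁ h₂ hα hβ h = 1 ↔
      ∃ x y, α = Ideal.span {x} ∧ β = Ideal.span {y} ∧ j₁ p K x = h * j₂ h₁ h₂ y :=
  (squareA h₁ h₂).picGlue_eq_one_iff hα hβ h

theorem exists_picM_eq (X : Pic (A h₁ h₂)) : ∃ (α : Ideal (𝓞 K)) (β : Ideal (𝓞 L))
    (hα : α.InvertibleAt (j₁ p K)) (hβ : β.InvertibleAt (j₂ h₁ h₂)) (h : (F p K)ˣ),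
      picM h₁ h₂ hα hβ h = X :=
  have := isLocalRing_F h₁
  (squareA h₁ h₂).exists_picGlue_eq X

end

theorem mapRingHom_projTwo_picM {α : Ideal (𝓞 K)} {β : Ideal (𝓞 L)}
    (hα : α.InvertibleAt (j₁ p K)) (hβ : β.InvertibleAt (j₂ h₁ h₂)) (h : (F p K)ˣ) :
    Pic.mapRingHom (projTwo h₁ h₂) (picM h₁ h₂ hα hβ h) =
      ClassGroup.equivPic (𝓞 L) (ClassGroup.mk0 ⟨β, ne_zero_of_invertibleAt h₁ h₂ hβ⟩) := by
  have : Module.Invertible (𝓞 L) β := hβ.invertible (squareA h₁ h₂).regular₂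
  rw [ClassGroup.equivPic_mk0 ⟨β, _⟩]
  exact (squareA h₁ h₂).mapRingHom_picGlue hα hβ h

theorem mem_B_iff (X : Pic (A h₁ h₂)) : X ∈ B h₁ h₂ ↔
    ∃ (α : Ideal (𝓞 K)) (hα : α.InvertibleAt (j₁ p K)) (h : (F p K)ˣ),
      picM h₁ h₂ hα .top h = X := by
  constructor
  · intro hX
    obtain ⟨α, β, hα, hβ, h, rfl⟩ := exists_picM_eq h₁ h₂ X
    have hX : Pic.mapRingHom (projTwo h₁ h₂) (picM h₁ h₂ hα hβ h) = 1 := hX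
    rw [mapRingHom_projTwo_picM, EmbeddingLike.map_eq_one_iff, ClassGroup.mk0_eq_one_iff] at hX
    obtain ⟨b, rfl⟩ := hX
    obtain ⟨c, hc, hu⟩ := hβ.exists_isUnit
    have hb : IsUnit (j₂ h₁ h₂ b) := by
      obtain ⟨d, rfl⟩ := Ideal.mem_span_singleton'.1 hc
      rw [map_mul] at hu
      exact isUnit_of_mul_isUnit_right hu
    -- This module is free on `(1, b)`. Splitting it off turns the second ideal `(b)` into the unit
    -- ideal and moves `j₂ b` into the gluing unit.
    have htriv : picM (p := p) (K := K) h₁ h₂ .top hβ hb.unit⁻¹ = 1 := by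
      rw [picM_eq_one_iff]
      refine ⟨1, b, Ideal.span_singleton_one.symm, rfl, ?_⟩
      rw [map_one]
      exact hb.val_inv_mul.symm
    refine ⟨α, hα, h * hb.unit, ?_⟩
    rw [← mul_one (picM h₁ h₂ hα _ _), ← htriv, picM_mul]
    exact picM_congr h₁ h₂ (Ideal.mul_top α) (Ideal.top_mul _)
      (mul_inv_cancel_right h hb.unit)
  · rintro ⟨α, hα, h, rfl⟩
    change Pic.mapRingHom (projTwo h₁ h₂) _ = 1
    rw [mapRingHom_projTwo_picM, EmbeddingLike.map_eq_one_iff, ClassGroup.mk0_eq_one_iff]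
    exact ⟨1, by simp⟩

/-! ### The norm: splitting and ray class group -/

variable [Algebra K L]

/-- The norm of `y` is a unit of `ℤ[ζ₁]` with the same image in `F` as `y`, so `x / N y` generates
the same ideal as `x` and reduces to `h`. -/
theorem exists_span_eq_of_isUnit (hζ : algebraMap K L ζ₁ = ζ₂ ^ p) {x : 𝓞 K} {y : 𝓞 L}
    (hy : IsUnit y) {h : (F p K)ˣ} (hxy : j₁ p K x = h * j₂ h₁ h₂ y) :
    ∃ a, Ideal.span {x} = Ideal.span {a} ∧ j₁ p K a = h := by
  obtain ⟨u, hu⟩ : IsUnit (Algebra.intNorm (𝓞 K) (𝓞 L) y) := hy.map _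
  refine ⟨x * ↑u⁻¹, Ideal.span_singleton_eq_span_singleton.2 ⟨u⁻¹, rfl⟩, ?_⟩
  rw [← j₁_intNorm h₁ h₂ hζ, ← hu] at hxy
  rw [map_mul, hxy, mul_assoc, ← map_mul, Units.mul_inv, map_one, mul_one]

theorem picM_top_eq_one_iff (hζ : algebraMap K L ζ₁ = ζ₂ ^ p) {α : Ideal (𝓞 K)}
    (hα : α.InvertibleAt (j₁ p K)) (h : (F p K)ˣ) :
    picM h₁ h₂ hα .top h = 1 ↔ ∃ a, α = Ideal.span {a} ∧ j₁ p K a = h := by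
  rw [picM_eq_one_iff]
  constructor
  · rintro ⟨x, y, rfl, hy, hxy⟩
    exact exists_span_eq_of_isUnit h₁ h₂ hζ (Ideal.span_singleton_eq_top.1 hy.symm) hxy
  · rintro ⟨a, rfl, ha⟩
    refine ⟨a, 1, rfl, Ideal.span_singleton_one.symm, ?_⟩
    rw [map_one, mul_one]
    exact ha

theorem invertibleAt_relNorm (hζ : algebraMap K L ζ₁ = ζ₂ ^ p) {β : Ideal (𝓞 L)}
    (hβ : β.InvertibleAt (j₂ h₁ h₂)) : (Ideal.relNorm (𝓞 K) β).InvertibleAt (j₁ p K) := by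
  obtain ⟨β', s, hs, hu⟩ := hβ
  refine ⟨Ideal.relNorm (𝓞 K) β', Algebra.intNorm (𝓞 K) (𝓞 L) s, ?_, ?_⟩
  · rw [← map_mul, hs, Ideal.relNorm_singleton]
  · rwa [j₁_intNorm h₁ h₂ hζ]

/-- For principal `β = (b)` the module `M(Nβ, β, 1)` is free on `(N b, b)`. Multiplicativity in `β`
is that of the ideal norm, and every ideal class has a representative of the required kind. -/
theorem exists_splitting (hζ : algebraMap K L ζ₁ = ζ₂ ^ p) :
    ∃ ψ : ClassGroup (𝓞 L) →* Pic (A h₁ h₂),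
      (∀ c, ∃ (β : Ideal (𝓞 L)) (hβ : β.InvertibleAt (j₂ h₁ h₂)),
        ClassGroup.mk0 ⟨β, ne_zero_of_invertibleAt h₁ h₂ hβ⟩ = c) ∧
      ∀ (β : Ideal (𝓞 L)) (hβ : β.InvertibleAt (j₂ h₁ h₂)),
        ψ (ClassGroup.mk0 ⟨β, ne_zero_of_invertibleAt h₁ h₂ hβ⟩) =
          picM h₁ h₂ (invertibleAt_relNorm h₁ h₂ hζ hβ) hβ 1 := by
  have := isLocalRing_F h₁
  let T := {β : Ideal (𝓞 L) // β.InvertibleAt (j₂ h₁ h₂)}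
  let u (β : T) : ClassGroup (𝓞 L) := ClassGroup.mk0 ⟨β.1, ne_zero_of_invertibleAt h₁ h₂ β.2⟩
  let v (β : T) : Pic (A h₁ h₂) := picM h₁ h₂ (invertibleAt_relNorm h₁ h₂ hζ β.2) β.2 1
  have hu : Function.Surjective u := by
    intro c
    obtain ⟨β, hβ, ⟨e⟩⟩ := Module.Invertible.exists_linearEquiv_invertibleAt
      (squareA h₁ h₂).regular₂ (ClassGroup.equivPic (𝓞 L) c)
    have : Module.Invertible (𝓞 L) β := hβ.invertible (squareA h₁ h₂).regular₂
    refine ⟨⟨β, hβ⟩, (ClassGroup.equivPic (𝓞 L)).injective ?_⟩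
    rw [ClassGroup.equivPic_mk0 ⟨β, _⟩]
    exact Pic.mk_eq_iff.2 ⟨e.symm⟩
  have hmul (s t : T) : ∃ r, u r = u s * u t ∧ v r = v s * v t := by
    refine ⟨⟨s.1 * t.1, s.2.mul t.2⟩, ?_, ?_⟩
    · rw [← map_mul]
      rfl
    · rw [picM_mul]
      exact picM_congr h₁ h₂ (map_mul _ _ _) rfl (mul_one 1).symm
  have hone (t : T) (h : u t = 1) : v t = 1 := by
    obtain ⟨β, hβ⟩ := t
    obtain ⟨b, rfl⟩ := (ClassGroup.mk0_eq_one_iff _).1 h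
    refine (picM_eq_one_iff h₁ h₂ _ _ _).2
      ⟨Algebra.intNorm (𝓞 K) (𝓞 L) b, b, Ideal.relNorm_singleton _ b, rfl, ?_⟩
    rw [Units.val_one, one_mul]
    exact j₁_intNorm h₁ h₂ hζ b
  obtain ⟨ψ, hψ⟩ := exists_monoidHom_of_surjective hu hmul hone
  exact ⟨ψ, fun c ↦ (hu c).elim fun β hβ ↦ ⟨β.1, β.2, hβ⟩, fun β hβ ↦ hψ ⟨β, hβ⟩⟩

theorem exists_mulEquiv_rayClassGroup (hζ : algebraMap K L ζ₁ = ζ₂ ^ p) :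
    ∃ Θ : B h₁ h₂ ≃* RayClassGroup p K,
      ∀ (X : B h₁ h₂) (α : Ideal (𝓞 K)) (hα : PrimeTo p α) (h : (F p K)ˣ) (x : 𝓞 K)
        (hx : j₁ p K x = h), IsClassOf h₁ h₂ X (M h₁ h₂ α ⊤ h) →
          Θ X = (primeTo_span hx).rayClass⁻¹ * hα.rayClass := by
  -- Pairs `(α, x)` represent both groups, through `M(α, ℤ[ζ₂], j₁ x)` and `x⁻¹α`. Both maps are
  -- onto and multiplicative, and `huv` says that they are trivial on the same pairs; this gives
  -- well-definedness and injectivity at once.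
  let T := {α : Ideal (𝓞 K) // PrimeTo p α} × {x : 𝓞 K // IsUnit (j₁ p K x)}
  have hT (t : T) := primeTo_iff_invertibleAt_one.1 t.1.2
  let u (t : T) : B h₁ h₂ := ⟨picM h₁ h₂ (hT t) .top t.2.2.unit,
    (mem_B_iff h₁ h₂ _).2 ⟨t.1.1, hT t, _, rfl⟩⟩
  let v (t : T) : RayClassGroup p K :=
    (primeTo_span t.2.2.unit_spec.symm).rayClass⁻¹ * t.1.2.rayClass
  have huv (t : T) : u t = 1 ↔ v t = 1 := by
    rw [rayClass_inv_mul_eq_one_iff t.2.2.unit_spec.symm t.1.2,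
      ← picM_top_eq_one_iff h₁ h₂ hζ (hT t), Subtype.ext_iff]
    rfl
  have hu : Function.Surjective u := by
    rintro ⟨X, hX⟩
    obtain ⟨α, hα, h, rfl⟩ := (mem_B_iff h₁ h₂ X).1 hX
    obtain ⟨x, hx⟩ := j₁_surjective p K h
    refine ⟨⟨⟨α, primeTo_iff_invertibleAt_one.2 hα⟩, ⟨x, hx ▸ h.isUnit⟩⟩, Subtype.ext ?_⟩
    exact picM_congr h₁ h₂ (hα := hα) (hβ := .top) (hγ := hα) (hδ := .top) rfl rfl (Units.ext hx)
  have hmul (s t : T) : ∃ r, u r = u s * u t ∧ v r = v s * v t := by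
    obtain ⟨⟨α, hα⟩, ⟨x, hx⟩⟩ := s
    obtain ⟨⟨β, hβ⟩, ⟨y, hy⟩⟩ := t
    have hxy : IsUnit (j₁ p K (x * y)) := by
      rw [map_mul]
      exact hx.mul hy
    refine ⟨⟨⟨α * β, IsCoprime.mul_left hα hβ⟩, ⟨x * y, hxy⟩⟩, Subtype.ext ?_, ?_⟩
    · refine Eq.trans ?_ (picM_mul h₁ h₂ (primeTo_iff_invertibleAt_one.1 hα) .top
        (primeTo_iff_invertibleAt_one.1 hβ) .top hx.unit hy.unit).symm
      exact picM_congr h₁ h₂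
        (hα := primeTo_iff_invertibleAt_one.1 (IsCoprime.mul_left hα hβ)) (hβ := .top) rfl (Ideal.mul_top _).symm (Units.ext (map_mul (j₁ p K) x y))
    · have e : Ideal.span {x * y} = Ideal.span {x} * Ideal.span {y} :=
        (Ideal.span_singleton_mul_span_singleton x y).symm
      have hs : PrimeTo p (Ideal.span {x} * Ideal.span {y}) :=
        e ▸ primeTo_span hxy.unit_spec.symm
      change (primeTo_span hxy.unit_spec.symm).rayClass⁻¹ * _ = _ * _ * (_ * _)
      rw [(primeTo_span hxy.unit_spec.symm).rayClass_congr hs e,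
        (primeTo_span hx.unit_spec.symm).rayClass_mul (primeTo_span hy.unit_spec.symm),
        hα.rayClass_mul hβ]
      exact inv_mul_mul_mul_comm (G := RayClassGroup p K) _ _ _ _
  obtain ⟨Θ, hΘ⟩ := exists_monoidHom_of_surjective hu hmul fun t ↦ (huv t).1
  have hbij : Function.Bijective Θ := by
    constructor
    · rw [injective_iff_map_eq_one]
      intro X hX
      obtain ⟨t, rfl⟩ := hu X
      rw [hΘ] at hX
      exact (huv t).2 hX
    · intro c
      obtain ⟨x, h, hx, α, hα, rfl⟩ := exists_rayClass_eq c
      exact ⟨u ⟨⟨α, hα⟩, ⟨x, hx ▸ h.isUnit⟩⟩, hΘ _⟩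
  refine ⟨MulEquiv.ofBijective Θ hbij, fun X α hα h x hx hX ↦ ?_⟩
  have hxu : IsUnit (j₁ p K x) := hx ▸ h.isUnit
  have hX' : X = u ⟨⟨α, hα⟩, ⟨x, hxu⟩⟩ := by
    refine Subtype.ext (Eq.symm ((picM_eq_iff h₁ h₂ (hα := primeTo_iff_invertibleAt_one.1 hα) (hβ := .top)).2 ?_))
    rwa [show hxu.unit = h from Units.ext hx]
  rw [hX']
  exact hΘ _

end CyclicPic

end

/-! ### The theorem -/

open CyclicPic in
theorem theorem2p1 (p : ℕ) [Fact p.Prime] (hp : p ≠ 2)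
    (K : Type*) [Field K] [NumberField K] [IsCyclotomicExtension {p} ℚ K]
    (L : Type*) [Field L] [NumberField L] [IsCyclotomicExtension {p ^ 2} ℚ L]
    [Algebra K L] (ζ₁ : K) (h₁ : IsPrimitiveRoot ζ₁ p) (ζ₂ : L) (h₂ : IsPrimitiveRoot ζ₂ (p ^ 2))
    (hζ : algebraMap K L ζ₁ = ζ₂ ^ p) :
    -- `Pic ℤC ≅ Pic A` through the canonical map
    Function.Bijective (Pic.mapRingHom (groupRingToA h₁ h₂)) ∧
    -- the modules `M(α₁, α₂, h)` are invertible
    (∀ (α₁ : Ideal (𝓞 K)) (α₂ : Ideal (𝓞 L)) (h : (F p K)ˣ), PrimeTo p α₁ → PrimeTo p α₂ →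
      Module.Invertible (A h₁ h₂) (M h₁ h₂ α₁ α₂ h)) ∧
    -- `α ↦ M(N α, α, 1)` splits the projection `Pic A → Cl ℤ[ζ₂]`, and `Pic A` is the direct
    -- product of its image and `B`
    (∃ ψ : ClassGroup (𝓞 L) →* Pic (A h₁ h₂),
      (∀ α : (Ideal (𝓞 L))⁰, PrimeTo p (α : Ideal (𝓞 L)) →
        IsClassOf h₁ h₂ (ψ (ClassGroup.mk0 α)) (M h₁ h₂ (Ideal.relNorm (𝓞 K) α.1) α 1)) ∧
      (Pic.mapRingHom (projTwo h₁ h₂)).comp ψ = (ClassGroup.equivPic (𝓞 L)).toMonoidHom ∧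
      IsCompl ψ.range (B h₁ h₂)) ∧
    -- `B` consists of the classes of the modules `M(α, ℤ[ζ₂], h)`
    (∀ X : Pic (A h₁ h₂), X ∈ B h₁ h₂ ↔ ∃ (α : Ideal (𝓞 K)) (h : (F p K)ˣ), PrimeTo p α ∧
      IsClassOf h₁ h₂ X (M h₁ h₂ α ⊤ h)) ∧
    -- `M(α, ℤ[ζ₂], h) ↦ h⁻¹ α` is a well-defined isomorphism `B ≅ I₀(K) / H`, which restricts
    -- to an isomorphism of the Sylow `p`-subgroups
    ∃ Θ : B h₁ h₂ ≃* RayClassGroup p K,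
      (∀ (X : B h₁ h₂) (α : Ideal (𝓞 K)) (hα : PrimeTo p α) (h : (F p K)ˣ) (x : 𝓞 K)
        (hx : j₁ p K x = h), IsClassOf h₁ h₂ X (M h₁ h₂ α ⊤ h) →
          Θ X = (primeTo_span hx).rayClass⁻¹ * hα.rayClass) ∧
      ∀ (P : Sylow p (B h₁ h₂)) (Q : Sylow p (RayClassGroup p K)),
        ∃ Θp : P ≃* Q, ∀ X : P, (Θp X : RayClassGroup p K) = Θ X := by
  have one {α : Ideal (𝓞 K)} : PrimeTo p α ↔ α.InvertibleAt (j₁ p K) :=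
    primeTo_iff_invertibleAt_one
  have two {α : Ideal (𝓞 L)} : PrimeTo p α ↔ α.InvertibleAt (j₂ h₁ h₂) :=
    primeTo_iff_invertibleAt_two h₁ h₂
  refine ⟨mapRingHom_groupRingToA_bijective h₁ h₂,
    fun α₁ α₂ h hα₁ hα₂ ↦ (squareA h₁ h₂).invertible_glue (one.1 hα₁) (two.1 hα₂) h, ?_, ?_, ?_⟩
  · obtain ⟨ψ, hu, hψ⟩ := exists_splitting h₁ h₂ hζ
    have hcomp : (Pic.mapRingHom (projTwo h₁ h₂)).comp ψ =
        (ClassGroup.equivPic (𝓞 L)).toMonoidHom := by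
      ext c
      obtain ⟨β, hβ, rfl⟩ := hu c
      rw [MonoidHom.comp_apply, hψ β hβ, mapRingHom_projTwo_picM]
      rfl
    exact ⟨ψ, fun α hα ↦ (picM_eq_iff h₁ h₂).1 (hψ α.1 (two.1 hα)).symm, hcomp,
      MonoidHom.isCompl_range_ker _ hcomp⟩
  · intro X
    rw [mem_B_iff]
    constructor
    · rintro ⟨α, hα, h, hX⟩
      exact ⟨α, h, one.2 hα, (picM_eq_iff h₁ h₂).1 hX⟩
    · rintro ⟨α, h, hα, hX⟩
      exact ⟨α, one.1 hα, h, (picM_eq_iff h₁ h₂).2 hX⟩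
  · obtain ⟨Θ, hΘ⟩ := exists_mulEquiv_rayClassGroup h₁ h₂ hζ
    exact ⟨Θ, hΘ, fun P Q ↦ Sylow.exists_mulEquiv_of_mulEquiv Θ P Q mul_comm⟩
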